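/- Let $d\ge 1$, let $a>0$, and let $X,X_1,X_2,\ldots$ be identically distributed random vectors in $\mathbb{R}^d$ on a common probability space, with $X_1,X_2,\ldots$ independent. Assume that the distribution of $X$ is absolutely continuous with respect to Lebesgue measure, that $\mathbb{E}\|X\|^4<\infty$, $\mathbb{E}[X]=0$ and $\mathbb{E}[XX^\top]=\mathrm{I}_d$, and that $X$ is not reflected symmetric, i.e. there is no $\mu\in\mathbb{R}^d$ for which $X-\mu$ and $\mu-X$ have the same distribution. For $n\ge d+1$ put $\overline{X}_n=n^{-1}\sum_{j=1}^n X_j$, $S_n=n^{-1}\sum_{j=1}^n(X_j-\overline{X}_n)(X_j-\overline{X}_n)^\top$ (which is almost surely invertible), $Y_{n,j}=S_n^{-1/2}(X_j-\overline{X}_n)$, where $S_n^{-1/2}$ is the symmetric positive definite square root of $S_n^{-1}$, and \[ T_{n,a}=\int_{\mathbb{R}^d}\Big(\frac{1}{\sqrt n}\sum_{j=1}^n\sin(t^\top Y_{n,j})\Big)^2 e^{-a\|t\|^2}\,\mathrm{d}t . \] For $t\in\mathbb{R}^d$ let \[ R(t)=\mathbb{E}[\cos(t^\top X)],\quad I(t)=\mathbb{E}[\sin(t^\top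 X)],\quad C(t)=\mathbb{E}[X\cos(t^\top X)],\quad S(t)=\mathbb{E}[X\sin(t^\top X)], \] and put $\Delta=\int_{\mathbb{R}^d}I(t)^2e^{-a\|t\|^2}\,\mathrm{d}t$. Then \[ \sqrt n\Big(\frac{T_{n,a}}{n}-\Delta\Big)\ \xrightarrow{\ \mathcal D\ }\ \mathrm{N}(0,\sigma^2)\qquad (n\to\infty), \] where \[ \sigma^2=4\int_{\mathbb{R}^d}\int_{\mathbb{R}^d}K(s,t)\,I(s)\,I(t)\,e^{-a(\|s\|^2+\|t\|^2)}\,\mathrm{d}s\,\mathrm{d}t \] (an absolutely convergent double integral with a nonnegative value; $\mathrm{N}(0,0)$ is the unit mass at $0$) and, for $s,t\in\mathbb{R}^d$, \begin{align*} K(s,t)={}&\mathbb{E}[\sin(s^\top X)\sin(t^\top X)]-I(s)I(t)-R(t)\,t^\top S(s)-R(s)\,s^\top S(t)+R(s)R(t)\,s^\top t\\ &-\tfrac12\,t^\top\mathbb{E}[\sin(s^\top X)XX^\top]C(t)+\tfrac12 I(s)\,t^\top C(t)\\ &-\tfrac12\,s^\top\mathbb{E}[\sin(t^\top X)XX^\top]C(s)+\tfrac12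 I(t)\,s^\top C(s)\\ &+\tfrac12 R(s)\,s^\top\mathbb{E}[X\,t^\top X\,X^\top]C(t)+\tfrac12 R(t)\,t^\top\mathbb{E}[X\,s^\top X\,X^\top]C(s)\\ &+\tfrac14\big\{C(s)^\top\mathbb{E}[XX^\top s\,t^\top XX^\top]C(t)-s^\top C(s)\,t^\top C(t)\big\}. \end{align*} -/

import Mathlib

open MeasureTheory ProbabilityTheory Filter
open scoped Matrix MatrixOrder

namespace HKM

noncomputable section

/-- The space of column vectors `ℝ^d` with the Euclidean norm. -/
abbrev Vec (d : ℕ) : Type := EuclideanSpace ℝ (Fin d)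

/-- The matrix `x yᵀ`. -/
def outer {d : ℕ} (x y : Vec d) : Matrix (Fin d) (Fin d) ℝ :=
  Matrix.vecMulVec x.ofLp y.ofLp

/-- The number `xᵀ A y`. -/
def quad {d : ℕ} (x : Vec d) (A : Matrix (Fin d) (Fin d) ℝ) (y : Vec d) : ℝ :=
  x.ofLp ⬝ᵥ (A *ᵥ y.ofLp)

/-! ### The test statistic, for a sample `x₁, …, xₙ` -/

/-- The sample mean. -/
def sampleMean {d n : ℕ} (x : Fin n → Vec d) : Vec d :=
  (n : ℝ)⁻¹ • ∑ j, x j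

/-- The sample covariance matrix `Sₙ = n⁻¹ ∑ⱼ (xⱼ - x̄)(xⱼ - x̄)ᵀ`. -/
def sampleCov {d n : ℕ} (x : Fin n → Vec d) : Matrix (Fin d) (Fin d) ℝ :=
  (n : ℝ)⁻¹ • ∑ j, outer (x j - sampleMean x) (x j - sampleMean x)

/-- The scaled residuals `Yₙⱼ = Sₙ^(-1/2) (xⱼ - x̄)`, where `Sₙ^(-1/2)` is the
symmetric positive semidefinite square root of `Sₙ⁻¹`. -/
def residual {d n : ℕ} (x : Fin n → Vec d) (j : Fin n) : Vec d :=
  WithLp.toLp 2 (CFC.sqrt (sampleCov x)⁻¹ *ᵥ (x j - sampleMean x).ofLp)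

/-- The statistic
`Tₙₐ = ∫ (n^(-1/2) ∑ⱼ sin(tᵀ Yₙⱼ))² exp(-a ‖t‖²) dt`. -/
def testStat {d n : ℕ} (a : ℝ) (x : Fin n → Vec d) : ℝ :=
  ∫ t : Vec d, (1 / √(n : ℝ) * ∑ j, Real.sin (inner ℝ t (residual x j))) ^ 2
    * Real.exp (-a * ‖t‖ ^ 2)

/-! ### Functionals of the distribution of a random vector `X` -/

section Functionals

variable {Ω : Type*} [MeasurableSpace Ω] {d : ℕ}

/-- The entrywise expectation of a random matrix. -/
def expMat (P : Measure Ω) (M : Ω → Matrix (Fin d) (Fin d) ℝ) : Matrix (Fin d) (Fin d) ℝ :=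
  Matrix.of fun i j => ∫ ω, M ω i j ∂P

/-- Reflected symmetry: `X - μ` and `μ - X` have the same distribution for some `μ`. -/
def ReflectedSymmetric (P : Measure Ω) (X : Ω → Vec d) : Prop :=
  ∃ μ : Vec d, IdentDistrib (fun ω => X ω - μ) (fun ω => μ - X ω) P P

/-- `R(t) = E[cos(tᵀX)]`. -/
def funR (P : Measure Ω) (X : Ω → Vec d) (t : Vec d) : ℝ :=
  ∫ ω, Real.cos (inner ℝ t (X ω)) ∂P

/-- `I(t) = E[sin(tᵀX)]`. -/
def funI (P : Measure Ω) (X : Ω → Vec d) (t : Vec d) : ℝ :=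
  ∫ ω, Real.sin (inner ℝ t (X ω)) ∂P

/-- `C(t) = E[X cos(tᵀX)]`. -/
def funC (P : Measure Ω) (X : Ω → Vec d) (t : Vec d) : Vec d :=
  ∫ ω, Real.cos (inner ℝ t (X ω)) • X ω ∂P

/-- `S(t) = E[X sin(tᵀX)]`. -/
def funS (P : Measure Ω) (X : Ω → Vec d) (t : Vec d) : Vec d :=
  ∫ ω, Real.sin (inner ℝ t (X ω)) • X ω ∂P

/-- `Δ = ∫ I(t)² exp(-a ‖t‖²) dt`. -/
def Delta (P : Measure Ω) (X : Ω → Vec d) (a : ℝ) : ℝ :=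
  ∫ t : Vec d, funI P X t ^ 2 * Real.exp (-a * ‖t‖ ^ 2)

/-- The covariance kernel `K(s,t)`. -/
def kernelK (P : Measure Ω) (X : Ω → Vec d) (s t : Vec d) : ℝ :=
  (∫ ω, Real.sin (inner ℝ s (X ω)) * Real.sin (inner ℝ t (X ω)) ∂P)
    - funI P X s * funI P X t
    - funR P X t * inner ℝ t (funS P X s)
    - funR P X s * inner ℝ s (funS P X t)
    + funR P X s * funR P X t * inner ℝ s t
    - 1 / 2 * quad t
        (expMat P fun ω => Real.sin (inner ℝ s (X ω)) • outer (X ω) (X ω)) (funC P X t)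
    + 1 / 2 * funI P X s * inner ℝ t (funC P X t)
    - 1 / 2 * quad s
        (expMat P fun ω => Real.sin (inner ℝ t (X ω)) • outer (X ω) (X ω)) (funC P X s)
    + 1 / 2 * funI P X t * inner ℝ s (funC P X s)
    + 1 / 2 * funR P X s * quad s
        (expMat P fun ω => (inner ℝ t (X ω) : ℝ) • outer (X ω) (X ω)) (funC P X t)
    + 1 / 2 * funR P X t * quad t
        (expMat P fun ω => (inner ℝ s (X ω) : ℝ) • outer (X ω) (X ω)) (funC P X s)
    + 1 / 4 * (quad (funC P X s)
          (expMat P fun ω => outer (X ω) (X ω) * outer s t * outer (X ω) (X ω)) (funC P X t)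
        - inner ℝ s (funC P X s) * inner ℝ t (funC P X t))

/-- The integrand `K(s,t) I(s) I(t) exp(-a (‖s‖² + ‖t‖²))`. -/
def varIntegrand (P : Measure Ω) (X : Ω → Vec d) (a : ℝ) (s t : Vec d) : ℝ :=
  kernelK P X s t * funI P X s * funI P X t * Real.exp (-a * (‖s‖ ^ 2 + ‖t‖ ^ 2))

/-- `σ² = 4 ∫∫ K(s,t) I(s) I(t) exp(-a (‖s‖² + ‖t‖²)) ds dt`. -/
def sigmaSq (P : Measure Ω) (X : Ω → Vec d) (a : ℝ) : ℝ :=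
  4 * ∫ s : Vec d, ∫ t : Vec d, varIntegrand P X a s t

end Functionals

end

end HKM

/-!
The proof is the delta method for the empirical sine transform of the scaled residuals.

Write `w(t) = exp(-a ‖t‖²)` and `gₙ(t) = n⁻¹ ∑ⱼ sin(tᵀ Yₙⱼ)`, so that `Tₙₐ / n = ∫ gₙ² w`. Since
`Yₙⱼ = Sₙ^(-1/2) (Xⱼ - X̄ₙ)` and `Sₙ^(-1/2) = 1 - (Sₙ - 1) / 2 + O(‖Sₙ - 1‖²)`, a Taylor expansion
of the sine gives `gₙ(t) - I(t) ≈ n⁻¹ ∑ⱼ ψ(Xⱼ, t)` with the centred influence function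
`ψ(x, t) = sin(tᵀx) - I(t) - R(t) tᵀx - (tᵀx xᵀC(t) - tᵀC(t)) / 2` (`influence`). Its covariance
kernel is `K` (`hasMean_influence_mul_influence`). Integrating `gₙ² - I² ≈ 2 I (gₙ - I)` against `w`,
`√n (Tₙₐ / n - Δ) ≈ n^(-1/2) ∑ⱼ 2 h(Xⱼ)` with `h(x) = ∫ ψ(x, t) I(t) w(t) dt` (`score`), and by
Fubini `E h(X) = 0` and `4 E h(X)² = σ²` (`sigmaSq_eq_variance`). The central limit theorem for the
`2 h(Xⱼ)` and Slutsky's lemma conclude; a vanishing `σ²` needs no separate treatment.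

The error of the linearization is controlled deterministically. For every sample it is at most a
constant times one quantity, `meanSqDev`, as soon as this quantity is small
(`exists_abs_testStat_sub_le`): a weighted integral of the squared deviations from their
expectations of the empirical means of `‖x‖²`, `xᵢ xₖ`, `xᵢ`, `xᵢ cos(tᵀx)`, `cos(tᵀx)` and
`sin(tᵀx)`. All of these functions grow at most quadratically in `x`, so four moments make the
expectation of `meanSqDev` of order `1/n` (`exists_lintegral_meanSqDev_le`), and `√n` times it tends
to zero in probability. The square root enters only through `A² = Sₙ⁻¹` and `A ≥ 0`: positivity
yields `‖A - 1‖ ≤ ‖A² - 1‖`, and `A - 1 = (A² - 1) / 2 - (A - 1)² / 2` is the expansion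
(`inverse_sqrt_perturbation`).

The statistic has to be measurable as well, for which the matrix square root must be a Borel
function on positive semidefinite matrices (`exists_measurable_eq_sqrt`).
-/

namespace HKM

/-! ### Perturbation of the inverse square root -/

section Operators

variable {E : Type*} [NormedAddCommGroup E] [InnerProductSpace ℝ E]

/-- If `A ≥ 0` then `A + 1` expands norms, so that `A - 1 = (A + 1)⁻¹ (A² - 1)` is no larger than
`A² - 1`. -/
lemma norm_sub_one_le_of_nonneg (A : E →L[ℝ] E) (hA : ∀ v, 0 ≤ inner ℝ v (A v)) :
    ‖A - 1‖ ≤ ‖A * A - 1‖ := by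
  refine ContinuousLinearMap.opNorm_le_bound _ (norm_nonneg _) fun v => ?_
  set u := (A - 1) v with hu
  have h1 : (A * A - 1) v = A u + u := by
    simp [hu]
  have h2 : ‖u‖ ≤ ‖A u + u‖ := by
    refine le_of_sq_le_sq ?_ (norm_nonneg _)
    rw [norm_add_sq_real, real_inner_comm]
    nlinarith [hA u, sq_nonneg ‖A u‖]
  exact h2.trans (h1 ▸ ContinuousLinearMap.le_opNorm _ _)

/-- First order expansion of `A = S ^ (-1/2)` at `S = 1`, with a quadratic bound on the error. The
operator `A` is determined by `A * A = Q = S⁻¹` and `A ≥ 0`. -/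
lemma inverse_sqrt_perturbation (A Q S : E →L[ℝ] E) (hA : ∀ v, 0 ≤ inner ℝ v (A v))
    (hAQ : A * A = Q) (hQS : Q * S = 1) (hS : ‖S - 1‖ ≤ 1 / 2) :
    ‖A - 1‖ ≤ 2 * ‖S - 1‖ ∧ ‖A - 1 + (1 / 2 : ℝ) • (S - 1)‖ ≤ 3 * ‖S - 1‖ ^ 2 := by
  set D := S - 1 with hD
  have hSD : S = 1 + D := by simp [hD]
  have hQ1 : Q - 1 = -(Q * D) := by
    rw [hSD, mul_add, mul_one] at hQS
    rw [← hQS]; abel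
  have hn1 : ‖(1 : E →L[ℝ] E)‖ ≤ 1 := ContinuousLinearMap.norm_id_le
  have hQD : ‖Q * D‖ ≤ ‖Q‖ * ‖D‖ := norm_mul_le _ _
  have hQ2 : ‖Q‖ ≤ 2 := by
    have h : ‖Q‖ ≤ ‖(1 : E →L[ℝ] E)‖ + ‖Q * D‖ := by
      have : Q = 1 - Q * D := by rw [sub_eq_add_neg, ← hQ1]; abel
      calc ‖Q‖ = ‖1 - Q * D‖ := by rw [← this]
        _ ≤ _ := norm_sub_le _ _
    nlinarith [norm_nonneg Q, norm_nonneg D]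
  have hQ1n : ‖Q - 1‖ ≤ 2 * ‖D‖ := by
    rw [hQ1, norm_neg]; nlinarith [norm_nonneg D]
  have hA1 : ‖A - 1‖ ≤ ‖Q - 1‖ := hAQ ▸ norm_sub_one_le_of_nonneg A hA
  refine ⟨hA1.trans hQ1n, ?_⟩
  -- `Q - 1 = 2 (A - 1) + (A - 1)²` and `Q - 1 = -D - (Q - 1) D`
  have key : A - 1 + (1 / 2 : ℝ) • D
      = -((1 / 2 : ℝ) • ((Q - 1) * D)) - (1 / 2 : ℝ) • ((A - 1) * (A - 1)) := by
    have e1 : (Q - 1) * D = -(Q - 1) - D := by rw [sub_mul, one_mul, hQ1]; abel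
    have e2 : (A - 1) * (A - 1) = (Q - 1) - (2 : ℝ) • (A - 1) := by
      rw [← hAQ, two_smul]; noncomm_ring
    rw [e1, e2]; module
  rw [key]
  have b1 : ‖(Q - 1) * D‖ ≤ 2 * ‖D‖ ^ 2 := by
    refine (norm_mul_le _ _).trans ?_
    nlinarith [norm_nonneg D]
  have b2 : ‖(A - 1) * (A - 1)‖ ≤ 4 * ‖D‖ ^ 2 := by
    refine (norm_mul_le _ _).trans ?_
    have := hA1.trans hQ1n
    nlinarith [norm_nonneg D, norm_nonneg (A - 1)]
  calc _ ≤ ‖-((1 / 2 : ℝ) • ((Q - 1) * D))‖ + ‖(1 / 2 : ℝ) • ((A - 1) * (A - 1))‖ :=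
        norm_sub_le _ _
    _ ≤ 3 * ‖D‖ ^ 2 := by
        rw [norm_neg, norm_smul, norm_smul, Real.norm_of_nonneg (by norm_num)]
        linarith

end Operators

/-! ### Matrices as operators -/

/-- The operator `v ↦ A v` on `ℝ^d`. -/
noncomputable abbrev toOp {d : ℕ} (A : Matrix (Fin d) (Fin d) ℝ) : Vec d →L[ℝ] Vec d :=
  Matrix.toEuclideanCLM (n := Fin d) (𝕜 := ℝ) A

lemma quad_eq_inner {d : ℕ} (x y : Vec d) (A : Matrix (Fin d) (Fin d) ℝ) :
    quad x A y = inner ℝ x (toOp A y) :=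
  (Matrix.inner_toEuclideanCLM A x y).symm

lemma toOp_smul {d : ℕ} (r : ℝ) (A : Matrix (Fin d) (Fin d) ℝ) : toOp (r • A) = r • toOp A :=
  map_smul (Matrix.toEuclideanCLM (n := Fin d) (𝕜 := ℝ)) r A

lemma toOp_mul {d : ℕ} (A B : Matrix (Fin d) (Fin d) ℝ) : toOp (A * B) = toOp A * toOp B :=
  map_mul (Matrix.toEuclideanCLM (n := Fin d) (𝕜 := ℝ)) A B

lemma toOp_outer {d : ℕ} (x y v : Vec d) : toOp (outer x y) v = (inner ℝ y v : ℝ) • x := by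
  ext i
  simp [Matrix.ofLp_toEuclideanCLM, outer, Matrix.vecMulVec_mulVec, PiLp.inner_apply,
    dotProduct, mul_comm]

/-- The operator norm is at most the Frobenius norm. -/
lemma norm_toOp_sq_le {d : ℕ} (A : Matrix (Fin d) (Fin d) ℝ) :
    ‖toOp A‖ ^ 2 ≤ ∑ i, ∑ j, A i j ^ 2 := by
  have h0 : 0 ≤ ∑ i, ∑ j, A i j ^ 2 :=
    Finset.sum_nonneg fun i _ => Finset.sum_nonneg fun j _ => sq_nonneg _
  have h : ‖toOp A‖ ≤ √(∑ i, ∑ j, A i j ^ 2) := by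
    refine ContinuousLinearMap.opNorm_le_bound _ (Real.sqrt_nonneg _) fun v => ?_
    refine le_of_sq_le_sq ?_ (by positivity)
    rw [mul_pow, Real.sq_sqrt h0, EuclideanSpace.real_norm_sq_eq, EuclideanSpace.real_norm_sq_eq,
      Finset.sum_mul]
    refine Finset.sum_le_sum fun i _ => ?_
    have : (toOp A v).ofLp i = ∑ j, A i j * v j := rfl
    rw [this]
    exact Finset.sum_mul_sq_le_sq_mul_sq _ _ _
  calc ‖toOp A‖ ^ 2 ≤ √(∑ i, ∑ j, A i j ^ 2) ^ 2 := by gcongr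
    _ = _ := Real.sq_sqrt h0

lemma sampleCov_posSemidef {d n : ℕ} (x : Fin n → Vec d) : (sampleCov x).PosSemidef := by
  unfold sampleCov
  refine Matrix.PosSemidef.smul (Matrix.posSemidef_sum _ fun j _ => ?_) (by positivity)
  simpa [outer] using
    Matrix.posSemidef_vecMulVec_self_star (R := ℝ) (x j - sampleMean x).ofLp

lemma sqrt_inv_sampleCov_mul_self {d n : ℕ} (x : Fin n → Vec d) :
    CFC.sqrt (sampleCov x)⁻¹ * CFC.sqrt (sampleCov x)⁻¹ = (sampleCov x)⁻¹ :=
  CFC.sqrt_mul_sqrt_self _ (sampleCov_posSemidef x).inv.nonneg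

lemma sqrt_inv_sampleCov_perturbation {d n : ℕ} (x : Fin n → Vec d)
    (hS : ‖toOp (sampleCov x) - 1‖ ≤ 1 / 2) :
    ‖toOp (CFC.sqrt (sampleCov x)⁻¹) - 1‖ ≤ 2 * ‖toOp (sampleCov x) - 1‖ ∧
      ‖toOp (CFC.sqrt (sampleCov x)⁻¹) - 1 + (1 / 2 : ℝ) • (toOp (sampleCov x) - 1)‖
        ≤ 3 * ‖toOp (sampleCov x) - 1‖ ^ 2 := by
  have hu : IsUnit (toOp (sampleCov x)) := by
    have : toOp (sampleCov x) = 1 - (1 - toOp (sampleCov x)) := by abel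
    rw [this]
    refine isUnit_one_sub_of_norm_lt_one ?_
    rw [norm_sub_rev]; linarith
  have hu' : IsUnit (sampleCov x) := by
    have := hu.map (Matrix.toEuclideanCLM (n := Fin d) (𝕜 := ℝ)).symm
    simpa using this
  refine inverse_sqrt_perturbation _ (toOp (sampleCov x)⁻¹) _ (fun v => ?_) ?_ ?_ hS
  · rw [← quad_eq_inner]
    have := (Matrix.nonneg_iff_posSemidef.1
      (CFC.sqrt_nonneg (sampleCov x)⁻¹)).dotProduct_mulVec_nonneg v.ofLp
    simpa [quad] using this
  · rw [← map_mul, sqrt_inv_sampleCov_mul_self]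
  · rw [← map_mul, Matrix.nonsing_inv_mul _ ((Matrix.isUnit_iff_isUnit_det _).1 hu'), map_one]

/-! ### Measurability of the statistic -/

/-- On positive semidefinite matrices the square root coincides with a Borel function: it inverts
the continuous injection `B ↦ B * B` of a Polish space, which is a measurable embedding. -/
lemma exists_measurable_eq_sqrt {d : ℕ} [MeasurableSpace (Matrix (Fin d) (Fin d) ℝ)]
    [BorelSpace (Matrix (Fin d) (Fin d) ℝ)] :
    ∃ f : Matrix (Fin d) (Fin d) ℝ → Matrix (Fin d) (Fin d) ℝ, Measurable f ∧
      ∀ A, A.PosSemidef → f A = CFC.sqrt A := by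
  let s : Set (Matrix (Fin d) (Fin d) ℝ) := {B | B.PosSemidef}
  have hs : IsClosed s := by
    have : s = {B | B.IsHermitian} ∩ ⋂ v : Fin d → ℝ, {B | 0 ≤ v ⬝ᵥ (B *ᵥ v)} := by
      ext B
      simp [s, Matrix.posSemidef_iff_dotProduct_mulVec]
    rw [this]
    refine IsClosed.inter ?_ (isClosed_iInter fun v => ?_)
    · exact isClosed_eq (by fun_prop) continuous_id
    · exact isClosed_le continuous_const (by fun_prop)
  have : PolishSpace (Matrix (Fin d) (Fin d) ℝ) :=
    inferInstanceAs (PolishSpace (Fin d → Fin d → ℝ))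
  have : PolishSpace s := hs.polishSpace
  have hemb : MeasurableEmbedding (fun B : s => B.1 * B.1) := by
    refine Continuous.measurableEmbedding (by fun_prop) fun B B' h => Subtype.ext ?_
    have h1 := CFC.sqrt_mul_self B.1 (Matrix.PosSemidef.nonneg B.2)
    have h2 := CFC.sqrt_mul_self B'.1 (Matrix.PosSemidef.nonneg B'.2)
    rw [← h1, ← h2]
    exact congrArg _ h
  obtain ⟨f, hf, hfe⟩ := hemb.exists_measurable_extend measurable_subtype_coe fun _ => ⟨0⟩
  refine ⟨f, hf, fun A hA => ?_⟩
  have h := congrFun hfe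
    ⟨CFC.sqrt A, Matrix.nonneg_iff_posSemidef.1 (CFC.sqrt_nonneg A)⟩
  simpa [CFC.sqrt_mul_sqrt_self A hA.nonneg] using h

lemma measurable_residual {d n : ℕ} (j : Fin n) :
    Measurable fun x : Fin n → Vec d => residual x j := by
  let : MeasurableSpace (Matrix (Fin d) (Fin d) ℝ) := borel _
  have : BorelSpace (Matrix (Fin d) (Fin d) ℝ) := ⟨rfl⟩
  have : SecondCountableTopology (Matrix (Fin d) (Fin d) ℝ) :=
    inferInstanceAs (SecondCountableTopology (Fin d → Fin d → ℝ))
  obtain ⟨f, hf, hfe⟩ := exists_measurable_eq_sqrt (d := d)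
  have hmean : Continuous fun x : Fin n → Vec d => sampleMean x := by
    unfold sampleMean; fun_prop
  have hcov : Continuous fun x : Fin n → Vec d => sampleCov x := by
    unfold sampleCov outer; fun_prop
  have hinv : Measurable fun x : Fin n → Vec d => (sampleCov x)⁻¹ := by
    simp only [Matrix.inv_def, Ring.inverse_eq_inv']
    exact (hcov.matrix_det.measurable.inv).smul hcov.matrix_adjugate.measurable
  have hmul : Continuous fun p : Matrix (Fin d) (Fin d) ℝ × Vec d =>
      (WithLp.toLp 2 (p.1 *ᵥ p.2.ofLp) : Vec d) := by
    fun_prop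
  have := hmul.measurable.comp
    ((hf.comp hinv).prodMk ((continuous_apply j).sub hmean).measurable)
  convert this using 2 with x
  simp only [Function.comp, hfe _ (sampleCov_posSemidef x).inv]
  rfl

lemma measurable_testStat {d n : ℕ} (a : ℝ) :
    Measurable fun x : Fin n → Vec d => testStat a x := by
  unfold testStat
  refine (StronglyMeasurable.integral_prod_right (f := fun (x : Fin n → Vec d) (t : Vec d) =>
    (1 / √(n : ℝ) * ∑ j, Real.sin (inner ℝ t (residual x j))) ^ 2
      * Real.exp (-a * ‖t‖ ^ 2)) ?_).measurable
  refine Measurable.stronglyMeasurable ?_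
  have hr (j : Fin n) : Measurable fun p : (Fin n → Vec d) × Vec d => residual p.1 j :=
    (measurable_residual j).comp measurable_fst
  simp only [Function.uncurry_def]
  fun_prop

/-! ### Expansion of the empirical sine transform of the residuals -/

section Expansion

variable {E : Type*} [NormedAddCommGroup E] [InnerProductSpace ℝ E]

lemma abs_sin_add_sub_le (u v : ℝ) :
    |Real.sin (u + v) - Real.sin u| ≤ |v| := by
  have h := Real.lipschitzWith_sin.dist_le_mul (u + v) u
  simpa [Real.dist_eq] using h

lemma abs_sin_add_sub_sub_le (u v : ℝ) :
    |Real.sin (u + v) - Real.sin u - Real.cos u * v| ≤ v ^ 2 := by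
  have h : Real.sin (u + v) - Real.sin u - Real.cos u * v
      = Real.sin u * (Real.cos v - 1) + Real.cos u * (Real.sin v - v) := by
    rw [Real.sin_add]; ring
  have hc : |Real.cos v - 1| ≤ v ^ 2 / 2 := by
    rw [abs_sub_comm, abs_of_nonneg (by linarith [Real.cos_le_one v])]
    linarith [Real.one_sub_sq_div_two_le_cos (x := v)]
  have hs : |Real.sin v - v| ≤ v ^ 2 / 2 := by
    have h3 := Real.abs_sub_sin_le v
    rw [abs_sub_comm, ← sq_abs v]
    rcases le_total |v| 3 with h | h
    · nlinarith [abs_nonneg v, sq_nonneg |v|]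
    · have h4 := abs_sub v (Real.sin v)
      nlinarith [Real.abs_sin_le_one v]
  have := abs_add_le (Real.sin u * (Real.cos v - 1)) (Real.cos u * (Real.sin v - v))
  rw [abs_mul, abs_mul] at this
  rw [h]
  nlinarith [Real.abs_sin_le_one u, Real.abs_cos_le_one u, abs_nonneg (Real.cos v - 1),
    abs_nonneg (Real.sin v - v)]

variable {n : ℕ}

lemma abs_mean_le {f g : Fin n → ℝ} (h : ∀ j, |f j| ≤ g j) :
    |(n : ℝ)⁻¹ * ∑ j, f j| ≤ (n : ℝ)⁻¹ * ∑ j, g j := by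
  rw [abs_mul, abs_of_nonneg (by positivity : (0 : ℝ) ≤ (n : ℝ)⁻¹)]
  gcongr
  exact (Finset.abs_sum_le_sum_abs _ _).trans (Finset.sum_le_sum fun j _ => h j)

lemma mean_sq_le (f : Fin n → ℝ) :
    ((n : ℝ)⁻¹ * ∑ j, f j) ^ 2 ≤ (n : ℝ)⁻¹ * ∑ j, f j ^ 2 := by
  rcases Nat.eq_zero_or_pos n with rfl | hn
  · simp
  have h := sq_sum_le_card_mul_sum_sq (s := Finset.univ) (f := f)
  have hn' : (0 : ℝ) < n := by exact_mod_cast hn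
  rw [Finset.card_univ, Fintype.card_fin] at h
  rw [mul_pow]
  calc (n : ℝ)⁻¹ ^ 2 * (∑ j, f j) ^ 2 ≤ (n : ℝ)⁻¹ ^ 2 * (n * ∑ j, f j ^ 2) := by gcongr
    _ = _ := by field_simp

lemma mean_norm_sq_residual_le (x : Fin n → E) (b : E) (A : E →L[ℝ] E) :
    (n : ℝ)⁻¹ * ∑ j, ‖A (x j - b) - x j‖ ^ 2
      ≤ 2 * ‖A - 1‖ ^ 2 * ((n : ℝ)⁻¹ * ∑ j, ‖x j‖ ^ 2) + 2 * (‖A‖ * ‖b‖) ^ 2 := by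
  have h (j : Fin n) : ‖A (x j - b) - x j‖ ^ 2
      ≤ 2 * ‖A - 1‖ ^ 2 * ‖x j‖ ^ 2 + 2 * (‖A‖ * ‖b‖) ^ 2 := by
    have e : A (x j - b) - x j = (A - 1) (x j) - A b := by
      simp [map_sub]; abel
    have h1 : ‖A (x j - b) - x j‖ ≤ ‖A - 1‖ * ‖x j‖ + ‖A‖ * ‖b‖ := by
      rw [e]
      exact (norm_sub_le _ _).trans (add_le_add (ContinuousLinearMap.le_opNorm _ _)
        (ContinuousLinearMap.le_opNorm _ _))
    calc _ ≤ (‖A - 1‖ * ‖x j‖ + ‖A‖ * ‖b‖) ^ 2 := by gcongr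
      _ ≤ _ := by nlinarith [sq_nonneg (‖A - 1‖ * ‖x j‖ - ‖A‖ * ‖b‖)]
  rcases Nat.eq_zero_or_pos n with rfl | hn
  · simp; positivity
  have hn' : (0 : ℝ) < n := by exact_mod_cast hn
  calc _ ≤ (n : ℝ)⁻¹ * ∑ j, (2 * ‖A - 1‖ ^ 2 * ‖x j‖ ^ 2 + 2 * (‖A‖ * ‖b‖) ^ 2) := by
        gcongr with j; exact h j
    _ = _ := by
        rw [Finset.sum_add_distrib, ← Finset.mul_sum]
        simp
        field_simp

/-- Second order Taylor expansion of `n⁻¹ ∑ sin(tᵀ A (xⱼ - b))` around `A = 1`, `b = 0`. -/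
lemma abs_mean_sin_residual_sub_le (x : Fin n → E) (b t : E) (A : E →L[ℝ] E) :
    |(n : ℝ)⁻¹ * ∑ j, Real.sin (inner ℝ t (A (x j - b)))
        - (n : ℝ)⁻¹ * ∑ j, Real.sin (inner ℝ t (x j))
        - (inner ℝ t ((A - 1) ((n : ℝ)⁻¹ • ∑ j, Real.cos (inner ℝ t (x j)) • x j))
          - ((n : ℝ)⁻¹ * ∑ j, Real.cos (inner ℝ t (x j))) * inner ℝ t (A b))|
      ≤ ‖t‖ ^ 2 * ((n : ℝ)⁻¹ * ∑ j, ‖A (x j - b) - x j‖ ^ 2) := by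
  have e : (n : ℝ)⁻¹ * ∑ j, Real.sin (inner ℝ t (A (x j - b)))
        - (n : ℝ)⁻¹ * ∑ j, Real.sin (inner ℝ t (x j))
        - (inner ℝ t ((A - 1) ((n : ℝ)⁻¹ • ∑ j, Real.cos (inner ℝ t (x j)) • x j))
          - ((n : ℝ)⁻¹ * ∑ j, Real.cos (inner ℝ t (x j))) * inner ℝ t (A b))
      = (n : ℝ)⁻¹ * ∑ j, (Real.sin (inner ℝ t (x j) + inner ℝ t (A (x j - b) - x j))
        - Real.sin (inner ℝ t (x j))
        - Real.cos (inner ℝ t (x j)) * inner ℝ t (A (x j - b) - x j)) := by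
    have e1 (j : Fin n) : (inner ℝ t (x j) : ℝ) + inner ℝ t (A (x j - b) - x j)
        = inner ℝ t (A (x j - b)) := by rw [← inner_add_right]; congr 1; abel
    have e2 (j : Fin n) : Real.cos (inner ℝ t (x j)) * inner ℝ t (A (x j - b) - x j)
        = inner ℝ t ((A - 1) (Real.cos (inner ℝ t (x j)) • x j))
          - Real.cos (inner ℝ t (x j)) * inner ℝ t (A b) := by
      simp only [map_sub, map_smul, inner_sub_right, inner_smul_right,
        _root_.sub_apply, one_apply_eq_self]
      ring
    simp only [e1, e2, Finset.sum_sub_distrib, map_smul, map_sum, inner_smul_right, inner_sum,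
      ← Finset.sum_mul]
    ring
  rw [e]
  refine (abs_mean_le (g := fun j => ‖t‖ ^ 2 * ‖A (x j - b) - x j‖ ^ 2) fun j => ?_).trans_eq ?_
  · refine (abs_sin_add_sub_sub_le _ _).trans ?_
    rw [← mul_pow, ← sq_abs]
    gcongr
    exact abs_real_inner_le_norm _ _
  · rw [← Finset.mul_sum]; ring

lemma mean_sin_residual_sub_sq_le (x : Fin n → E) (b t : E) (A : E →L[ℝ] E) :
    ((n : ℝ)⁻¹ * ∑ j, Real.sin (inner ℝ t (A (x j - b)))
        - (n : ℝ)⁻¹ * ∑ j, Real.sin (inner ℝ t (x j))) ^ 2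
      ≤ ‖t‖ ^ 2 * ((n : ℝ)⁻¹ * ∑ j, ‖A (x j - b) - x j‖ ^ 2) := by
  rw [← mul_sub, ← Finset.sum_sub_distrib]
  refine (mean_sq_le _).trans ?_
  rw [mul_left_comm]
  gcongr
  rw [Finset.mul_sum]
  refine Finset.sum_le_sum fun j _ => ?_
  rw [← mul_pow, ← sq_abs]
  gcongr
  have h := abs_sin_add_sub_le (inner ℝ t (x j)) (inner ℝ t (A (x j - b) - x j))
  rw [← inner_add_right, add_sub_cancel] at h
  exact h.trans (abs_real_inner_le_norm _ _)

/-- The bookkeeping of error terms, for `τ = ‖t‖`, `e = ‖A - 1‖`, `δ = ‖D‖` and a bound `c` for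
`‖C(t)‖`: every term is at most quadratic in the deviations `ν` of the second moments, `β` of the
mean, and `γ`, `ρ` of the empirical versions of `C(t)`, `R(t)`. -/
lemma error_terms_le {τ e δ ν β γ ρ c m M : ℝ} (hτ : 0 ≤ τ) (he : 0 ≤ e) (hδ : 0 ≤ δ)
    (hν : 0 ≤ ν) (hβ : 0 ≤ β) (hc : 0 ≤ c) (hm : 0 ≤ m) (hmM : m ≤ M)
    (heδ : e ≤ 2 * δ) (hδν : δ ≤ ν + β ^ 2) (hβ1 : β ≤ 1) :
    τ ^ 2 * (2 * e ^ 2 * m + 2 * (2 * β) ^ 2) ≤ (1 + τ ^ 2) * (16 * M + 8) * (ν ^ 2 + β ^ 2) ∧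
    τ * (e * γ) + τ * (3 * δ ^ 2 * c) + τ * (β * (β * c)) + τ * (e * β) + ρ * (τ * β)
      ≤ (1 + τ ^ 2) * (7 * c + 10) * (ν ^ 2 + β ^ 2 + γ ^ 2 + ρ ^ 2) := by
  set z := ν ^ 2 + β ^ 2 with hz
  have hz0 : 0 ≤ z := by positivity
  have hδz : δ ^ 2 ≤ 2 * z := by
    have h1 : δ ≤ ν + β := hδν.trans (by nlinarith)
    nlinarith [sq_nonneg (ν - β)]
  have hez : e ^ 2 ≤ 8 * z := by nlinarith
  have hτ1 : τ ≤ 1 + τ ^ 2 := by nlinarith [sq_nonneg (τ - 1)]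
  have hβz : β ^ 2 ≤ z := by nlinarith [sq_nonneg ν]
  constructor
  · have h1 : 2 * e ^ 2 * m + 2 * (2 * β) ^ 2 ≤ (16 * M + 8) * z := by
      have : e ^ 2 * m ≤ 8 * z * M := mul_le_mul hez hmM hm (by positivity)
      nlinarith
    have h2 : 0 ≤ (16 * M + 8) * z := by
      have := hm.trans hmM
      positivity
    nlinarith [sq_nonneg τ]
  · have h1 : e * γ + 3 * δ ^ 2 * c + β * (β * c) + e * β + ρ * β
        ≤ (7 * c + 10) * (z + γ ^ 2 + ρ ^ 2) := by
      have a1 : e * γ ≤ 4 * z + γ ^ 2 := by nlinarith [sq_nonneg (e - γ), sq_nonneg γ]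
      have a2 : 3 * δ ^ 2 * c ≤ 6 * z * c := by nlinarith
      have a3 : β * (β * c) ≤ z * c := by nlinarith
      have a4 : e * β ≤ 5 * z := by nlinarith [sq_nonneg (e - β)]
      have a5 : ρ * β ≤ z + ρ ^ 2 := by nlinarith [sq_nonneg (ρ - β), sq_nonneg ρ]
      have a6 : 0 ≤ c * γ ^ 2 := by positivity
      have a7 : 0 ≤ c * ρ ^ 2 := by positivity
      nlinarith [sq_nonneg γ, sq_nonneg ρ]
    have h2 : 0 ≤ (7 * c + 10) * (z + γ ^ 2 + ρ ^ 2) := by positivity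
    calc _ = τ * (e * γ + 3 * δ ^ 2 * c + β * (β * c) + e * β + ρ * β) := by ring
      _ ≤ τ * ((7 * c + 10) * (z + γ ^ 2 + ρ ^ 2)) := by gcongr
      _ ≤ (1 + τ ^ 2) * ((7 * c + 10) * (z + γ ^ 2 + ρ ^ 2)) := by gcongr
      _ = _ := by ring

/-- Pointwise linearization of the squared empirical sine transform of the residuals. Here `I`, `R`,
`C` stand for the values at `t` of the population functionals, `b` for the sample mean, and
`1 + N` for the empirical second moment matrix, so that `1 + D` is the sample covariance. -/
lemma abs_sq_mean_sin_residual_sub_le (x : Fin n → E) (b t C : E) (A N D : E →L[ℝ] E)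
    (I R c M : ℝ)
    (hD : ∀ v, D v = N v - (inner ℝ b v : ℝ) • b) (hDn : ‖D‖ ≤ 1 / 2)
    (hA1 : ‖A - 1‖ ≤ 2 * ‖D‖) (hA2 : ‖A - 1 + (1 / 2 : ℝ) • D‖ ≤ 3 * ‖D‖ ^ 2)
    (hb1 : ‖b‖ ≤ 1) (hI : |I| ≤ 1) (hC : ‖C‖ ≤ c)
    (hM : (n : ℝ)⁻¹ * ∑ j, ‖x j‖ ^ 2 ≤ M) :
    |((n : ℝ)⁻¹ * ∑ j, Real.sin (inner ℝ t (A (x j - b)))) ^ 2 - I ^ 2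
        - 2 * I * ((n : ℝ)⁻¹ * ∑ j, Real.sin (inner ℝ t (x j)) - I - R * inner ℝ t b
          - 1 / 2 * inner ℝ t (N C))|
      ≤ (1 + ‖t‖ ^ 2) * (64 * M + 14 * c + 54) * (‖N‖ ^ 2 + ‖b‖ ^ 2
        + ‖(n : ℝ)⁻¹ • ∑ j, Real.cos (inner ℝ t (x j)) • x j - C‖ ^ 2
        + ((n : ℝ)⁻¹ * ∑ j, Real.cos (inner ℝ t (x j)) - R) ^ 2
        + ((n : ℝ)⁻¹ * ∑ j, Real.sin (inner ℝ t (x j)) - I) ^ 2) := by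
  have hlin := abs_mean_sin_residual_sub_le x b t A
  have hsq := mean_sin_residual_sub_sq_le x b t A
  have hres := mean_norm_sq_residual_le x b A
  have hm0 : 0 ≤ (n : ℝ)⁻¹ * ∑ j, ‖x j‖ ^ 2 := by positivity
  have hR1 : |(n : ℝ)⁻¹ * ∑ j, Real.cos (inner ℝ t (x j))| ≤ 1 := by
    refine (abs_mean_le (g := fun _ => 1) fun j => Real.abs_cos_le_one _).trans ?_
    rcases Nat.eq_zero_or_pos n with rfl | hn
    · simp
    · have : (n : ℝ) ≠ 0 := by positivity
      simp [this]
  set g := (n : ℝ)⁻¹ * ∑ j, Real.sin (inner ℝ t (A (x j - b))) with hg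
  set In := (n : ℝ)⁻¹ * ∑ j, Real.sin (inner ℝ t (x j)) with hIn
  set Rn := (n : ℝ)⁻¹ * ∑ j, Real.cos (inner ℝ t (x j)) with hRn
  set Cn := (n : ℝ)⁻¹ • ∑ j, Real.cos (inner ℝ t (x j)) • x j with hCn
  set m := (n : ℝ)⁻¹ * ∑ j, ‖x j‖ ^ 2 with hmdef
  set r := (n : ℝ)⁻¹ * ∑ j, ‖A (x j - b) - x j‖ ^ 2 with hr
  clear_value g In Rn Cn m r
  have hAn : ‖A‖ ≤ 2 := by
    have : ‖A‖ ≤ ‖A - 1‖ + ‖(1 : E →L[ℝ] E)‖ := by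
      simpa using norm_add_le (A - 1) 1
    have h1 : ‖(1 : E →L[ℝ] E)‖ ≤ 1 := ContinuousLinearMap.norm_id_le
    linarith
  have hδν : ‖D‖ ≤ ‖N‖ + ‖b‖ ^ 2 := by
    refine ContinuousLinearMap.opNorm_le_bound _ (by positivity) fun v => ?_
    rw [hD, add_mul]
    refine (norm_sub_le _ _).trans (add_le_add (N.le_opNorm v) ?_)
    rw [norm_smul]
    have := norm_inner_le_norm (𝕜 := ℝ) b v
    nlinarith [norm_nonneg b]
  obtain ⟨e1, e2⟩ := error_terms_le (τ := ‖t‖) (e := ‖A - 1‖) (δ := ‖D‖) (ν := ‖N‖) (β := ‖b‖)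
    (γ := ‖Cn - C‖) (ρ := |Rn - R|) (c := c) (m := m) (M := M) (norm_nonneg _) (norm_nonneg _)
    (norm_nonneg _) (norm_nonneg _) (norm_nonneg _) ((norm_nonneg _).trans hC) hm0 hM hA1 hδν hb1
  have hτr : ‖t‖ ^ 2 * r ≤ (1 + ‖t‖ ^ 2) * (16 * M + 8) * (‖N‖ ^ 2 + ‖b‖ ^ 2) := by
    refine le_trans ?_ e1
    gcongr
    refine hres.trans ?_
    gcongr
  -- the five first order error terms
  have t1 : |(inner ℝ t ((A - 1) (Cn - C)) : ℝ)| ≤ ‖t‖ * (‖A - 1‖ * ‖Cn - C‖) :=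
    (abs_real_inner_le_norm _ _).trans (by gcongr; exact ContinuousLinearMap.le_opNorm _ _)
  have t2 : |(inner ℝ t ((A - 1 + (1 / 2 : ℝ) • D) C) : ℝ)| ≤ ‖t‖ * (3 * ‖D‖ ^ 2 * c) :=
    (abs_real_inner_le_norm _ _).trans (by
      gcongr; exact ContinuousLinearMap.le_of_opNorm_le_of_le _ hA2 hC)
  have t3 : |1 / 2 * (inner ℝ b C * inner ℝ t b : ℝ)| ≤ ‖t‖ * (‖b‖ * (‖b‖ * c)) := by
    rw [abs_mul, abs_mul]
    have a1 := abs_real_inner_le_norm b C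
    have a2 := abs_real_inner_le_norm t b
    have a3 : |(inner ℝ b C : ℝ)| * |(inner ℝ t b : ℝ)| ≤ (‖b‖ * c) * (‖t‖ * ‖b‖) :=
      mul_le_mul (a1.trans (by gcongr)) a2 (abs_nonneg _)
        (mul_nonneg (norm_nonneg _) ((norm_nonneg _).trans hC))
    have a4 : 0 ≤ |(inner ℝ b C : ℝ)| * |(inner ℝ t b : ℝ)| := by positivity
    rw [abs_of_pos (by norm_num : (0 : ℝ) < 1 / 2)]
    nlinarith
  have t4 : |Rn * (inner ℝ t ((A - 1) b) : ℝ)| ≤ ‖t‖ * (‖A - 1‖ * ‖b‖) := by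
    rw [abs_mul]
    have : |(inner ℝ t ((A - 1) b) : ℝ)| ≤ ‖t‖ * (‖A - 1‖ * ‖b‖) :=
      (abs_real_inner_le_norm _ _).trans (by gcongr; exact ContinuousLinearMap.le_opNorm _ _)
    exact (mul_le_of_le_one_left (abs_nonneg _) hR1).trans this
  have t5 : |(Rn - R) * (inner ℝ t b : ℝ)| ≤ |Rn - R| * (‖t‖ * ‖b‖) := by
    rw [abs_mul]; gcongr; exact abs_real_inner_le_norm _ _
  have hdecomp : g - I - (In - I - R * inner ℝ t b - 1 / 2 * inner ℝ t (N C))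
      = (g - In - (inner ℝ t ((A - 1) Cn) - Rn * inner ℝ t (A b)))
        + inner ℝ t ((A - 1) (Cn - C)) + inner ℝ t ((A - 1 + (1 / 2 : ℝ) • D) C)
        + 1 / 2 * (inner ℝ b C * inner ℝ t b) - Rn * inner ℝ t ((A - 1) b)
        - (Rn - R) * inner ℝ t b := by
    simp only [map_sub, inner_sub_right, inner_add_right, inner_smul_right, hD,
      _root_.sub_apply, _root_.add_apply,
      _root_.smul_apply, one_apply_eq_self]
    ring
  have hGL : |g - I - (In - I - R * inner ℝ t b - 1 / 2 * inner ℝ t (N C))|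
      ≤ (1 + ‖t‖ ^ 2) * (16 * M + 8) * (‖N‖ ^ 2 + ‖b‖ ^ 2)
        + (1 + ‖t‖ ^ 2) * (7 * c + 10) * (‖N‖ ^ 2 + ‖b‖ ^ 2 + ‖Cn - C‖ ^ 2 + |Rn - R| ^ 2) := by
    rw [hdecomp]
    refine le_trans ?_ (add_le_add hτr e2)
    rw [abs_le] at hlin t1 t2 t3 t4 t5 ⊢
    constructor <;> linarith [hlin.1, hlin.2, t1.1, t1.2, t2.1, t2.2, t3.1, t3.2, t4.1, t4.2,
      t5.1, t5.2]
  have hG2 : (g - I) ^ 2 ≤ 2 * (In - I) ^ 2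
      + 2 * ((1 + ‖t‖ ^ 2) * (16 * M + 8) * (‖N‖ ^ 2 + ‖b‖ ^ 2)) := by
    have h1 : (g - I) ^ 2 ≤ 2 * (g - In) ^ 2 + 2 * (In - I) ^ 2 := by
      linarith [sq_nonneg ((g - In) - (In - I))]
    linarith [hsq.trans hτr]
  set L := In - I - R * inner ℝ t b - 1 / 2 * inner ℝ t (N C) with hL
  clear_value L
  have hfin : g ^ 2 - I ^ 2 - 2 * I * L = (g - I) ^ 2 + 2 * (I * (g - I - L)) := by ring
  have hIGL : |I * (g - I - L)| ≤ |g - I - L| := by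
    rw [abs_mul]; exact mul_le_of_le_one_left (abs_nonneg _) hI
  rw [hfin]
  have hab : |(g - I) ^ 2 + 2 * (I * (g - I - L))| ≤ (g - I) ^ 2 + 2 * |I * (g - I - L)| := by
    refine (abs_add_le _ _).trans ?_
    rw [abs_of_nonneg (sq_nonneg _), abs_mul, abs_of_pos (by norm_num : (0 : ℝ) < 2)]
  rw [sq_abs] at hGL
  have hc0 : 0 ≤ c := (norm_nonneg _).trans hC
  have hM0 : 0 ≤ M := hm0.trans hM
  have q : 0 ≤ 2 * ((1 + ‖t‖ ^ 2) * (‖N‖ ^ 2 + ‖b‖ ^ 2))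
      + (1 + ‖t‖ ^ 2) * (64 * M + 34) * (‖Cn - C‖ ^ 2 + (Rn - R) ^ 2)
      + (1 + ‖t‖ ^ 2) * (64 * M + 14 * c + 52) * (In - I) ^ 2
      + 2 * (‖t‖ ^ 2 * (In - I) ^ 2) := by positivity
  refine (hab.trans (add_le_add hG2 (mul_le_mul_of_nonneg_left (hIGL.trans hGL) zero_le_two))).trans
    (sub_nonneg.1 (q.trans_eq ?_))
  ring

end Expansion

/-! ### The Gaussian weight -/

/-- The weight function `exp(-a ‖t‖²)`. -/
noncomputable def weight {d : ℕ} (a : ℝ) (t : Vec d) : ℝ := Real.exp (-a * ‖t‖ ^ 2)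

lemma weight_pos {d : ℕ} (a : ℝ) (t : Vec d) : 0 < weight a t := Real.exp_pos _

@[fun_prop]
lemma continuous_weight {d : ℕ} (a : ℝ) : Continuous (weight a : Vec d → ℝ) := by
  unfold weight; fun_prop

lemma integrable_weight {d : ℕ} {a : ℝ} (ha : 0 < a) : Integrable (weight a : Vec d → ℝ) := by
  have h := (GaussianFourier.integrable_cexp_neg_mul_sq_norm_add (V := Vec d) (b := (a : ℂ))
    (by simpa using ha) 0 0).norm
  refine h.congr (ae_of_all _ fun t => ?_)
  simp only [weight, Complex.norm_exp]
  congr 1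
  simp [← Complex.ofReal_pow]

lemma integrable_one_add_sq_mul_weight {d : ℕ} {a : ℝ} (ha : 0 < a) :
    Integrable fun t : Vec d => (1 + ‖t‖ ^ 2) * weight a t := by
  refine ((integrable_weight (d := d) (half_pos ha)).const_mul (1 + 2 / a)).mono'
    (by fun_prop) (ae_of_all _ fun t => ?_)
  rw [Real.norm_of_nonneg (by have := weight_pos a t; positivity)]
  have h1 : weight a t = weight (a / 2) t * weight (a / 2) t := by
    rw [weight, weight, ← Real.exp_add]; congr 1; ring
  have h2 : (1 + ‖t‖ ^ 2) * weight (a / 2) t ≤ 1 + 2 / a := by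
    have h3 : weight (a / 2) t ≤ 1 := by
      rw [weight, Real.exp_le_one_iff]; nlinarith [sq_nonneg ‖t‖]
    have h4 : a / 2 * ‖t‖ ^ 2 * weight (a / 2) t ≤ 1 := by
      have h5 := Real.add_one_le_exp (a / 2 * ‖t‖ ^ 2)
      have h6 : weight (a / 2) t * Real.exp (a / 2 * ‖t‖ ^ 2) = 1 := by
        rw [weight, ← Real.exp_add]; simp
      nlinarith [weight_pos (a / 2) t]
    have h7 : ‖t‖ ^ 2 * weight (a / 2) t ≤ 2 / a := by
      rw [le_div_iff₀ ha]; nlinarith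
    nlinarith
  rw [h1, ← mul_assoc]
  exact mul_le_mul_of_nonneg_right h2 (weight_pos _ t).le

/-! ### Bilinear forms of expected matrices -/

lemma quad_outer {d : ℕ} (x y u v : Vec d) :
    quad x (outer u v) y = inner ℝ x u * inner ℝ v y := by
  rw [quad_eq_inner, toOp_outer, inner_smul_right, mul_comm]

lemma quad_smul_outer {d : ℕ} (r : ℝ) (x y u v : Vec d) :
    quad x (r • outer u v) y = r * (inner ℝ x u * inner ℝ v y) := by
  rw [quad_eq_inner, toOp_smul, smul_apply, inner_smul_right, ← quad_eq_inner, quad_outer]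

lemma quad_outer_mul_outer_mul_outer {d : ℕ} (x y u v s t : Vec d) :
    quad x (outer u u * outer s t * outer v v) y
      = inner ℝ x u * inner ℝ u s * (inner ℝ t v * inner ℝ v y) := by
  rw [quad_eq_inner, toOp_mul, toOp_mul]
  simp only [mul_apply_eq_comp, toOp_outer, inner_smul_right]
  ring

lemma quad_expMat {Ω : Type*} [MeasurableSpace Ω] {P : Measure Ω} {d : ℕ}
    {M : Ω → Matrix (Fin d) (Fin d) ℝ}
    (hM : ∀ x y : Vec d, Integrable (fun ω => quad x (M ω) y) P) (x y : Vec d) :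
    quad x (expMat P M) y = ∫ ω, quad x (M ω) y ∂P := by
  have hM' (i j : Fin d) : Integrable (fun ω => M ω i j) P := by
    refine (hM (EuclideanSpace.single i 1) (EuclideanSpace.single j 1)).congr
      (ae_of_all _ fun ω => ?_)
    simp [quad]
  simp only [quad, expMat, dotProduct, Matrix.mulVec, Matrix.of_apply]
  rw [integral_finsetSum]
  · refine Finset.sum_congr rfl fun i _ => ?_
    rw [integral_const_mul, integral_finsetSum]
    · simp_rw [integral_mul_const]
    · exact fun j _ => (hM' i j).mul_const _
  · exact fun i _ => (integrable_finsetSum _ fun j _ => (hM' i j).mul_const _).const_mul _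

/-! ### The population functionals -/

section Functionals

variable {Ω : Type*} [MeasurableSpace Ω] {P : Measure Ω} [IsProbabilityMeasure P] {d : ℕ}
  {X : Ω → Vec d}

lemma integrable_one_add_sq (hX : Measurable X) (hmom : Integrable (fun ω => ‖X ω‖ ^ 4) P) :
    Integrable (fun ω => (1 + ‖X ω‖ ^ 2) ^ 2) P := by
  refine ((integrable_const (2 : ℝ)).add (hmom.const_mul 2)).mono' (by fun_prop)
    (ae_of_all _ fun ω => ?_)
  rw [Real.norm_of_nonneg (by positivity)]
  simp only [Pi.add_apply]
  nlinarith [sq_nonneg (‖X ω‖ ^ 2 - 1)]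

/-- Measurable functions of `X` of at most quartic growth are integrable. -/
lemma integrable_of_quartic (hX : Measurable X) (hmom : Integrable (fun ω => ‖X ω‖ ^ 4) P)
    {F : Type*} [NormedAddCommGroup F] {f : Ω → F} (hf : AEStronglyMeasurable f P) (K : ℝ)
    (hb : ∀ ω, ‖f ω‖ ≤ K * (1 + ‖X ω‖ ^ 2) ^ 2) : Integrable f P :=
  ((integrable_one_add_sq hX hmom).const_mul K).mono' hf (ae_of_all _ hb)

lemma integrable_of_quadratic (hX : Measurable X) (hmom : Integrable (fun ω => ‖X ω‖ ^ 4) P)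
    {F : Type*} [NormedAddCommGroup F] {f : Ω → F} (hf : AEStronglyMeasurable f P)
    (hb : ∀ ω, ‖f ω‖ ≤ 1 + ‖X ω‖ ^ 2) : Integrable f P :=
  integrable_of_quartic hX hmom hf 1 fun ω => (hb ω).trans (by nlinarith [sq_nonneg ‖X ω‖])

lemma le_one_add_sq (r : ℝ) : r ≤ 1 + r ^ 2 := by nlinarith [sq_nonneg (r - 1)]

lemma abs_apply_le_norm (x : Vec d) (i : Fin d) : |x i| ≤ ‖x‖ := PiLp.norm_apply_le x i

lemma measurable_funI (hX : Measurable X) : Measurable (funI P X) :=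
  (StronglyMeasurable.integral_prod_right (f := fun (t : Vec d) ω => Real.sin (inner ℝ t (X ω)))
    (Measurable.stronglyMeasurable (by simp only [Function.uncurry_def]; fun_prop))).measurable

lemma measurable_funR (hX : Measurable X) : Measurable (funR P X) :=
  (StronglyMeasurable.integral_prod_right (f := fun (t : Vec d) ω => Real.cos (inner ℝ t (X ω)))
    (Measurable.stronglyMeasurable (by simp only [Function.uncurry_def]; fun_prop))).measurable

lemma measurable_funC (hX : Measurable X) : Measurable (funC P X) :=
  (StronglyMeasurable.integral_prod_right
    (f := fun (t : Vec d) ω => Real.cos (inner ℝ t (X ω)) • X ω)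
    (Measurable.stronglyMeasurable (by simp only [Function.uncurry_def]; fun_prop))).measurable

lemma abs_funI_le (t : Vec d) : |funI P X t| ≤ 1 := by
  simpa [funI] using norm_integral_le_of_norm_le_const (μ := P)
    (f := fun ω => Real.sin (inner ℝ t (X ω))) (ae_of_all _ fun ω => Real.abs_sin_le_one (inner ℝ t (X ω)))

lemma abs_funR_le (t : Vec d) : |funR P X t| ≤ 1 := by
  simpa [funR] using norm_integral_le_of_norm_le_const (μ := P)
    (f := fun ω => Real.cos (inner ℝ t (X ω))) (ae_of_all _ fun ω => Real.abs_cos_le_one (inner ℝ t (X ω)))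

lemma norm_funC_le (hX : Measurable X) (hmom : Integrable (fun ω => ‖X ω‖ ^ 4) P) (t : Vec d) :
    ‖funC P X t‖ ≤ ∫ ω, ‖X ω‖ ∂P := by
  refine norm_integral_le_of_norm_le (integrable_of_quadratic hX hmom (by fun_prop) fun ω => ?_)
    (ae_of_all _ fun ω => ?_)
  · simpa using le_one_add_sq ‖X ω‖
  · rw [norm_smul]
    exact mul_le_of_le_one_left (norm_nonneg _) (Real.abs_cos_le_one _)

/-- The influence function `ψ(x, t)` of the empirical sine transform of the scaled residuals:
`n⁻¹ ∑ⱼ sin(tᵀ Yₙⱼ) - I(t)` is `n⁻¹ ∑ⱼ ψ(Xⱼ, t)` up to an error of order `1/n`. -/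
noncomputable def influence (P : Measure Ω) (X : Ω → Vec d) (x t : Vec d) : ℝ :=
  Real.sin (inner ℝ t x) - funI P X t - funR P X t * inner ℝ t x
    - 1 / 2 * (inner ℝ t x * inner ℝ x (funC P X t) - inner ℝ t (funC P X t))

lemma measurable_influence (hX : Measurable X) :
    Measurable fun p : Vec d × Vec d => influence P X p.1 p.2 := by
  have hI := measurable_funI (P := P) hX
  have hR := measurable_funR (P := P) hX
  have hC := measurable_funC (P := P) hX
  unfold influence
  fun_prop

lemma abs_influence_le (hX : Measurable X) (hmom : Integrable (fun ω => ‖X ω‖ ^ 4) P)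
    (x t : Vec d) :
    |influence P X x t| ≤ (3 + ∫ ω, ‖X ω‖ ∂P) * ((1 + ‖x‖ ^ 2) * (1 + ‖t‖ ^ 2)) := by
  set c := ∫ ω, ‖X ω‖ ∂P
  have hC : ‖funC P X t‖ ≤ c := norm_funC_le hX hmom t
  have hc : 0 ≤ c := (norm_nonneg _).trans hC
  have b1 := Real.abs_sin_le_one (inner ℝ t x)
  have b2 := abs_funI_le (P := P) (X := X) t
  have htx : |(inner ℝ t x : ℝ)| ≤ ‖t‖ * ‖x‖ := abs_real_inner_le_norm t x
  have b3 : |funR P X t * inner ℝ t x| ≤ ‖t‖ * ‖x‖ := by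
    rw [abs_mul]
    exact (mul_le_of_le_one_left (abs_nonneg _) (abs_funR_le t)).trans htx
  have b4 : |(inner ℝ t x : ℝ) * inner ℝ x (funC P X t)| ≤ ‖t‖ * ‖x‖ ^ 2 * c := by
    rw [abs_mul]
    calc _ ≤ (‖t‖ * ‖x‖) * (‖x‖ * c) := by
          gcongr
          exact (abs_real_inner_le_norm _ _).trans (by gcongr)
      _ = _ := by ring
  have b5 : |(inner ℝ t (funC P X t) : ℝ)| ≤ ‖t‖ * c :=
    (abs_real_inner_le_norm _ _).trans (by gcongr)
  have hsum : |influence P X x t| ≤ 2 + ‖t‖ * ‖x‖ + 1 / 2 * (‖t‖ * ‖x‖ ^ 2 * c + ‖t‖ * c) := by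
    unfold influence
    rw [abs_le] at b1 b2 b3 b4 b5 ⊢
    constructor <;> linarith [b1.1, b1.2, b2.1, b2.2, b3.1, b3.2, b4.1, b4.2, b5.1, b5.2]
  have ht := le_one_add_sq ‖t‖
  have hx := le_one_add_sq ‖x‖
  have h1 : ‖t‖ * ‖x‖ ≤ (1 + ‖t‖ ^ 2) * (1 + ‖x‖ ^ 2) := by gcongr
  have h2 : ‖t‖ * ((1 + ‖x‖ ^ 2) * c) ≤ (1 + ‖t‖ ^ 2) * ((1 + ‖x‖ ^ 2) * c) := by gcongr
  have h3 : 1 ≤ (1 + ‖t‖ ^ 2) * (1 + ‖x‖ ^ 2) := by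
    nlinarith [sq_nonneg ‖t‖, sq_nonneg ‖x‖, mul_nonneg (sq_nonneg ‖t‖) (sq_nonneg ‖x‖)]
  have h4 : 0 ≤ (1 + ‖t‖ ^ 2) * ((1 + ‖x‖ ^ 2) * c) := by positivity
  linarith

end Functionals

/-! ### The covariance kernel -/

section Kernel

variable {Ω : Type*} [MeasurableSpace Ω] {P : Measure Ω} {d : ℕ}

/-- `f` is integrable with expectation `v`. -/
def HasMean (P : Measure Ω) (f : Ω → ℝ) (v : ℝ) : Prop :=
  Integrable f P ∧ ∫ ω, f ω ∂P = v

lemma HasMean.add {f g : Ω → ℝ} {u v : ℝ} (hf : HasMean P f u) (hg : HasMean P g v) :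
    HasMean P (fun ω => f ω + g ω) (u + v) :=
  ⟨hf.1.add hg.1, by rw [integral_add hf.1 hg.1, hf.2, hg.2]⟩

lemma HasMean.const_mul {f : Ω → ℝ} {u : ℝ} (c : ℝ) (hf : HasMean P f u) :
    HasMean P (fun ω => c * f ω) (c * u) :=
  ⟨hf.1.const_mul c, by rw [integral_const_mul, hf.2]⟩

/-- `f` is measurable and grows at most like `‖X‖²`. -/
def QuadraticGrowth (X : Ω → Vec d) (f : Ω → ℝ) : Prop :=
  Measurable f ∧ ∃ K, ∀ ω, |f ω| ≤ K * (1 + ‖X ω‖ ^ 2)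

variable {X : Ω → Vec d}

lemma quadraticGrowth_of_bounded {f : Ω → ℝ} (hf : Measurable f) {c : ℝ}
    (h : ∀ ω, |f ω| ≤ c) : QuadraticGrowth X f :=
  ⟨hf, c, fun ω => by
    have := (abs_nonneg _).trans (h ω)
    nlinarith [h ω, mul_nonneg this (sq_nonneg ‖X ω‖)]⟩

lemma quadraticGrowth_inner (hX : Measurable X) (u : Vec d) :
    QuadraticGrowth X fun ω => inner ℝ u (X ω) :=
  ⟨by fun_prop, ‖u‖, fun ω => (abs_real_inner_le_norm _ _).trans
    (mul_le_mul_of_nonneg_left (le_one_add_sq _) (norm_nonneg _))⟩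

lemma quadraticGrowth_inner_mul_inner (hX : Measurable X) (u v : Vec d) :
    QuadraticGrowth X fun ω => inner ℝ u (X ω) * inner ℝ (X ω) v := by
  refine ⟨by fun_prop, ‖u‖ * ‖v‖, fun ω => ?_⟩
  rw [abs_mul]
  calc _ ≤ (‖u‖ * ‖X ω‖) * (‖X ω‖ * ‖v‖) :=
        mul_le_mul (abs_real_inner_le_norm _ _) (abs_real_inner_le_norm _ _) (abs_nonneg _)
          (by positivity)
    _ = ‖u‖ * ‖v‖ * ‖X ω‖ ^ 2 := by ring
    _ ≤ _ := mul_le_mul_of_nonneg_left (by linarith) (by positivity)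

lemma quadraticGrowth_sin (hX : Measurable X) (u : Vec d) :
    QuadraticGrowth X fun ω => Real.sin (inner ℝ u (X ω)) :=
  quadraticGrowth_of_bounded (by fun_prop) fun _ => Real.abs_sin_le_one _

variable [IsProbabilityMeasure P]

lemma QuadraticGrowth.integrable_mul (hX : Measurable X)
    (hmom : Integrable (fun ω => ‖X ω‖ ^ 4) P) {f g : Ω → ℝ} (hf : QuadraticGrowth X f)
    (hg : QuadraticGrowth X g) : Integrable (fun ω => f ω * g ω) P := by
  obtain ⟨hf, A, hA⟩ := hf
  obtain ⟨hg, B, hB⟩ := hg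
  refine integrable_of_quartic hX hmom (hf.mul hg).aestronglyMeasurable (A * B) fun ω => ?_
  rw [norm_mul]
  calc _ ≤ (A * (1 + ‖X ω‖ ^ 2)) * (B * (1 + ‖X ω‖ ^ 2)) :=
        mul_le_mul (hA ω) (hB ω) (abs_nonneg _) ((abs_nonneg _).trans (hA ω))
    _ = _ := by ring

lemma QuadraticGrowth.integrable (hX : Measurable X)
    (hmom : Integrable (fun ω => ‖X ω‖ ^ 4) P) {f : Ω → ℝ} (hf : QuadraticGrowth X f) :
    Integrable f P := by
  simpa using hf.integrable_mul hX hmom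
    (quadraticGrowth_of_bounded (X := X) (f := fun _ => 1) measurable_const (c := 1) (by simp))

lemma integrable_self (hX : Measurable X) (hmom : Integrable (fun ω => ‖X ω‖ ^ 4) P) :
    Integrable X P :=
  integrable_of_quadratic hX hmom (by fun_prop) fun _ => le_one_add_sq _

lemma hasMean_const (c : ℝ) : HasMean P (fun _ => c) c := ⟨integrable_const _, by simp⟩

lemma hasMean_inner (hX : Measurable X) (hmom : Integrable (fun ω => ‖X ω‖ ^ 4) P)
    (hmean : ∫ ω, X ω ∂P = 0) (u : Vec d) : HasMean P (fun ω => inner ℝ u (X ω)) 0 :=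
  ⟨(quadraticGrowth_inner hX u).integrable hX hmom, by
    rw [integral_inner (integrable_self hX hmom), hmean, inner_zero_right]⟩

lemma hasMean_inner_mul_inner (hX : Measurable X) (hmom : Integrable (fun ω => ‖X ω‖ ^ 4) P)
    (hcov : expMat P (fun ω => outer (X ω) (X ω)) = 1) (u v : Vec d) :
    HasMean P (fun ω => inner ℝ u (X ω) * inner ℝ (X ω) v) (inner ℝ u v) := by
  have hint (u v : Vec d) := (quadraticGrowth_inner_mul_inner hX u v).integrable hX hmom
  refine ⟨hint u v, ?_⟩
  have h := quad_expMat (P := P) (M := fun ω => outer (X ω) (X ω))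
    (by simpa only [quad_outer] using hint) u v
  simp only [quad_outer] at h
  rw [← h, hcov, quad_eq_inner, toOp, map_one, one_apply_eq_self]

lemma hasMean_sin (hX : Measurable X) (hmom : Integrable (fun ω => ‖X ω‖ ^ 4) P) (s : Vec d) :
    HasMean P (fun ω => Real.sin (inner ℝ s (X ω))) (funI P X s) :=
  ⟨(quadraticGrowth_sin hX s).integrable hX hmom, rfl⟩

lemma hasMean_sin_mul_inner (hX : Measurable X) (hmom : Integrable (fun ω => ‖X ω‖ ^ 4) P)
    (s t : Vec d) :
    HasMean P (fun ω => Real.sin (inner ℝ s (X ω)) * inner ℝ t (X ω))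
      (inner ℝ t (funS P X s)) := by
  refine ⟨(quadraticGrowth_sin hX s).integrable_mul hX hmom (quadraticGrowth_inner hX t), ?_⟩
  rw [funS, ← integral_inner]
  · simp only [inner_smul_right]
  · refine integrable_of_quadratic hX hmom (by fun_prop) fun ω => ?_
    rw [norm_smul]
    exact (mul_le_of_le_one_left (norm_nonneg _) (Real.abs_sin_le_one _)).trans (le_one_add_sq _)

lemma hasMean_mul_inner_mul_inner (hX : Measurable X)
    (hmom : Integrable (fun ω => ‖X ω‖ ^ 4) P) {f : Ω → ℝ} (hf : QuadraticGrowth X f)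
    (u v : Vec d) :
    HasMean P (fun ω => f ω * (inner ℝ u (X ω) * inner ℝ (X ω) v))
      (quad u (expMat P fun ω => f ω • outer (X ω) (X ω)) v) := by
  have hint (u v : Vec d) :=
    hf.integrable_mul hX hmom (quadraticGrowth_inner_mul_inner hX u v)
  refine ⟨hint u v, ?_⟩
  rw [quad_expMat (by simpa only [quad_smul_outer] using hint)]
  simp only [quad_smul_outer]

lemma hasMean_inner_pow_four (hX : Measurable X) (hmom : Integrable (fun ω => ‖X ω‖ ^ 4) P)
    (s t u v : Vec d) :
    HasMean P (fun ω => inner ℝ u (X ω) * inner ℝ (X ω) s * (inner ℝ t (X ω) * inner ℝ (X ω) v))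
      (quad u (expMat P fun ω => outer (X ω) (X ω) * outer s t * outer (X ω) (X ω)) v) := by
  have hint (u v : Vec d) := (quadraticGrowth_inner_mul_inner hX u s).integrable_mul hX hmom
    (quadraticGrowth_inner_mul_inner hX t v)
  refine ⟨hint u v, ?_⟩
  rw [quad_expMat (by simpa only [quad_outer_mul_outer_mul_outer] using hint)]
  simp only [quad_outer_mul_outer_mul_outer]

lemma hasMean_influence (hX : Measurable X) (hmom : Integrable (fun ω => ‖X ω‖ ^ 4) P)
    (hmean : ∫ ω, X ω ∂P = 0) (hcov : expMat P (fun ω => outer (X ω) (X ω)) = 1) (t : Vec d) :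
    HasMean P (fun ω => influence P X (X ω) t) 0 := by
  have h := (((hasMean_sin hX hmom t).add (hasMean_const (-funI P X t))).add
    ((hasMean_inner hX hmom hmean t).const_mul (-funR P X t))).add
    (((hasMean_inner_mul_inner hX hmom hcov t (funC P X t)).add
      (hasMean_const (-inner ℝ t (funC P X t)))).const_mul (-(1 / 2)))
  convert h using 1
  · ext ω; unfold influence; ring
  · ring

/-- `K` is the covariance kernel of the process `t ↦ ψ(X, t)`. -/
lemma hasMean_influence_mul_influence (hX : Measurable X)
    (hmom : Integrable (fun ω => ‖X ω‖ ^ 4) P) (hmean : ∫ ω, X ω ∂P = 0)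
    (hcov : expMat P (fun ω => outer (X ω) (X ω)) = 1) (s t : Vec d) :
    HasMean P (fun ω => influence P X (X ω) s * influence P X (X ω) t) (kernelK P X s t) := by
  -- the product is expanded, and its terms are grouped by their degree as polynomials in `X`
  set cs := funC P X s with hcs
  set ct := funC P X t with hct
  have hss : HasMean P (fun ω => Real.sin (inner ℝ s (X ω)) * Real.sin (inner ℝ t (X ω)))
      (∫ ω, Real.sin (inner ℝ s (X ω)) * Real.sin (inner ℝ t (X ω)) ∂P) :=
    ⟨(quadraticGrowth_sin hX s).integrable_mul hX hmom (quadraticGrowth_sin hX t), rfl⟩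
  have h1 := (((hss.add ((hasMean_sin hX hmom s).const_mul
      (-funI P X t + 1 / 2 * inner ℝ t ct))).add
    ((hasMean_sin hX hmom t).const_mul (-funI P X s + 1 / 2 * inner ℝ s cs))).add
    ((hasMean_sin_mul_inner hX hmom s t).const_mul (-funR P X t))).add
    ((hasMean_sin_mul_inner hX hmom t s).const_mul (-funR P X s))
  have h2 := ((hasMean_inner hX hmom hmean s).const_mul
      (funR P X s * funI P X t - 1 / 2 * funR P X s * inner ℝ t ct)).add
    ((hasMean_inner hX hmom hmean t).const_mul
      (funR P X t * funI P X s - 1 / 2 * funR P X t * inner ℝ s cs))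
  have h3 := (((hasMean_inner_mul_inner hX hmom hcov s t).const_mul
      (funR P X s * funR P X t)).add
    ((hasMean_inner_mul_inner hX hmom hcov t ct).const_mul
      (1 / 2 * funI P X s - 1 / 4 * inner ℝ s cs))).add
    ((hasMean_inner_mul_inner hX hmom hcov s cs).const_mul
      (1 / 2 * funI P X t - 1 / 4 * inner ℝ t ct))
  have h4 := (((hasMean_mul_inner_mul_inner hX hmom (quadraticGrowth_sin hX s) t ct).const_mul
      (-(1 / 2))).add
    ((hasMean_mul_inner_mul_inner hX hmom (quadraticGrowth_sin hX t) s cs).const_mul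
      (-(1 / 2)))).add
    (((hasMean_mul_inner_mul_inner hX hmom (quadraticGrowth_inner hX t) s ct).const_mul
      (1 / 2 * funR P X s)).add
    ((hasMean_mul_inner_mul_inner hX hmom (quadraticGrowth_inner hX s) t cs).const_mul
      (1 / 2 * funR P X t)))
  have h5 := ((hasMean_inner_pow_four hX hmom s t cs ct).const_mul (1 / 4)).add
    (hasMean_const (P := P) (funI P X s * funI P X t - 1 / 2 * funI P X s * inner ℝ t ct
      - 1 / 2 * funI P X t * inner ℝ s cs + 1 / 4 * (inner ℝ s cs * inner ℝ t ct)))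
  convert (((h1.add h2).add h3).add h4).add h5 using 1
  · ext ω
    unfold influence
    rw [← hcs, ← hct, real_inner_comm t (X ω), real_inner_comm s (X ω),
      real_inner_comm (X ω) cs]
    ring
  · unfold kernelK
    rw [← hcs, ← hct]
    ring

end Kernel

/-! ### The linear statistic and its variance -/

section Score

variable {Ω : Type*} [MeasurableSpace Ω] {P : Measure Ω} {d : ℕ} {X : Ω → Vec d}

/-- The integrand `ψ(x, t) I(t) exp(-a ‖t‖²)` of the score. -/
noncomputable def scoreIntegrand (P : Measure Ω) (X : Ω → Vec d) (a : ℝ) (x t : Vec d) : ℝ :=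
  influence P X x t * funI P X t * weight a t

/-- The function `h(x) = ∫ ψ(x, t) I(t) exp(-a ‖t‖²) dt`; the normalized statistic behaves like
`n^(-1/2) ∑ⱼ 2 h(Xⱼ)`. -/
noncomputable def score (P : Measure Ω) (X : Ω → Vec d) (a : ℝ) (x : Vec d) : ℝ :=
  ∫ t, scoreIntegrand P X a x t

variable [IsProbabilityMeasure P]

lemma measurable_scoreIntegrand (hX : Measurable X) (a : ℝ) :
    Measurable fun p : Vec d × Vec d => scoreIntegrand P X a p.1 p.2 := by
  have h1 := measurable_influence (P := P) hX
  have h2 := measurable_funI (P := P) hX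
  unfold scoreIntegrand
  fun_prop

lemma abs_scoreIntegrand_le (hX : Measurable X) (hmom : Integrable (fun ω => ‖X ω‖ ^ 4) P)
    (a : ℝ) (x t : Vec d) :
    |scoreIntegrand P X a x t|
      ≤ (3 + ∫ ω, ‖X ω‖ ∂P) * (1 + ‖x‖ ^ 2) * ((1 + ‖t‖ ^ 2) * weight a t) := by
  have h := abs_influence_le (P := P) hX hmom x t
  have hw := weight_pos a t
  rw [scoreIntegrand, abs_mul, abs_mul, abs_of_pos hw]
  calc _ ≤ |influence P X x t| * weight a t :=
        mul_le_mul_of_nonneg_right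
          (mul_le_of_le_one_right (abs_nonneg _) (abs_funI_le t)) hw.le
    _ ≤ (3 + ∫ ω, ‖X ω‖ ∂P) * ((1 + ‖x‖ ^ 2) * (1 + ‖t‖ ^ 2)) * weight a t := by gcongr
    _ = _ := by ring

lemma integrable_scoreIntegrand (hX : Measurable X)
    (hmom : Integrable (fun ω => ‖X ω‖ ^ 4) P) {a : ℝ} (ha : 0 < a) (x : Vec d) :
    Integrable (scoreIntegrand P X a x) :=
  ((integrable_one_add_sq_mul_weight ha).const_mul _).mono'
    ((measurable_scoreIntegrand hX a).comp measurable_prodMk_left).aestronglyMeasurable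
    (ae_of_all _ fun t => abs_scoreIntegrand_le hX hmom a x t)

lemma measurable_score (hX : Measurable X) (a : ℝ) : Measurable (score P X a) :=
  (StronglyMeasurable.integral_prod_right (f := scoreIntegrand P X a)
    (measurable_scoreIntegrand hX a).stronglyMeasurable).measurable

lemma quadraticGrowth_score (hX : Measurable X)
    (hmom : Integrable (fun ω => ‖X ω‖ ^ 4) P) {a : ℝ} (ha : 0 < a) :
    QuadraticGrowth X fun ω => score P X a (X ω) := by
  refine ⟨(measurable_score hX a).comp hX,
    (3 + ∫ ω, ‖X ω‖ ∂P) * ∫ t : Vec d, (1 + ‖t‖ ^ 2) * weight a t, fun ω => ?_⟩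
  refine (norm_integral_le_of_norm_le (f := scoreIntegrand P X a (X ω)) ((integrable_one_add_sq_mul_weight ha).const_mul
    ((3 + ∫ ω, ‖X ω‖ ∂P) * (1 + ‖X ω‖ ^ 2)))
    (ae_of_all _ fun t => abs_scoreIntegrand_le hX hmom a (X ω) t)).trans_eq ?_
  rw [integral_const_mul]
  ring

lemma memLp_score (hX : Measurable X) (hmom : Integrable (fun ω => ‖X ω‖ ^ 4) P) {a : ℝ}
    (ha : 0 < a) : MemLp (fun ω => score P X a (X ω)) 2 P := by
  have h := quadraticGrowth_score (P := P) hX hmom ha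
  rw [memLp_two_iff_integrable_sq h.1.aestronglyMeasurable]
  simpa only [sq] using h.integrable_mul hX hmom h

lemma integral_score (hX : Measurable X) (hmom : Integrable (fun ω => ‖X ω‖ ^ 4) P)
    (hmean : ∫ ω, X ω ∂P = 0) (hcov : expMat P (fun ω => outer (X ω) (X ω)) = 1)
    {a : ℝ} (ha : 0 < a) : ∫ ω, score P X a (X ω) ∂P = 0 := by
  have hint : Integrable (Function.uncurry fun ω t => scoreIntegrand P X a (X ω) t)
      (P.prod volume) := by
    have h1 : Integrable (fun ω => (3 + ∫ ω, ‖X ω‖ ∂P) * (1 + ‖X ω‖ ^ 2)) P :=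
      (integrable_of_quadratic hX hmom (by fun_prop) fun ω => by
        rw [Real.norm_of_nonneg (by positivity)]).const_mul _
    refine (h1.mul_prod (integrable_one_add_sq_mul_weight (d := d) ha)).mono' ?_
      (ae_of_all _ fun p => abs_scoreIntegrand_le hX hmom a (X p.1) p.2)
    exact ((measurable_scoreIntegrand hX a).comp
      ((hX.comp measurable_fst).prodMk measurable_snd)).aestronglyMeasurable
  unfold score
  rw [integral_integral_swap hint]
  simp only [scoreIntegrand, integral_mul_const, (hasMean_influence hX hmom hmean hcov _).2,
    zero_mul, integral_zero]

/-- Fubini for the square of the score: the covariance integrand is integrable, and its integral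
is the second moment of `h(X)`. -/
lemma integrable_varIntegrand_and_integral_eq (hX : Measurable X)
    (hmom : Integrable (fun ω => ‖X ω‖ ^ 4) P) (hmean : ∫ ω, X ω ∂P = 0)
    (hcov : expMat P (fun ω => outer (X ω) (X ω)) = 1) {a : ℝ} (ha : 0 < a) :
    Integrable (fun p : Vec d × Vec d => varIntegrand P X a p.1 p.2) ∧
      ∫ s : Vec d, ∫ t : Vec d, varIntegrand P X a s t = ∫ ω, score P X a (X ω) ^ 2 ∂P := by
  set F : Ω → Vec d × Vec d → ℝ := fun ω p =>
    scoreIntegrand P X a (X ω) p.1 * scoreIntegrand P X a (X ω) p.2 with hF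
  have hint : Integrable (Function.uncurry F) (P.prod volume) := by
    have h0 := integrable_one_add_sq_mul_weight (d := d) ha
    have h1 := (integrable_one_add_sq hX hmom).const_mul ((3 + ∫ ω, ‖X ω‖ ∂P) ^ 2)
    refine (h1.mul_prod (h0.mul_prod h0)).mono' ?_ (ae_of_all _ fun p => ?_)
    · have hm := measurable_scoreIntegrand (P := P) hX a
      exact ((hm.comp ((hX.comp measurable_fst).prodMk (measurable_fst.comp measurable_snd))).mul
        (hm.comp ((hX.comp measurable_fst).prodMk
          (measurable_snd.comp measurable_snd)))).aestronglyMeasurable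
    · simp only [Function.uncurry, hF, norm_mul]
      refine (mul_le_mul (abs_scoreIntegrand_le hX hmom a (X p.1) p.2.1)
        (abs_scoreIntegrand_le hX hmom a (X p.1) p.2.2) (abs_nonneg _)
        ((abs_nonneg _).trans (abs_scoreIntegrand_le hX hmom a (X p.1) p.2.1))).trans_eq ?_
      ring
  have hK (p : Vec d × Vec d) : ∫ ω, F ω p ∂P = varIntegrand P X a p.1 p.2 := by
    have h (ω : Ω) : F ω p = (influence P X (X ω) p.1 * influence P X (X ω) p.2)
        * (funI P X p.1 * funI P X p.2 * (weight a p.1 * weight a p.2)) := by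
      simp only [hF, scoreIntegrand]; ring
    simp only [h]
    rw [integral_mul_const, (hasMean_influence_mul_influence hX hmom hmean hcov p.1 p.2).2,
      varIntegrand, weight, weight, ← Real.exp_add]
    ring_nf
  have hvar : Integrable (fun p : Vec d × Vec d => varIntegrand P X a p.1 p.2) := by
    have := hint.integral_prod_right
    simpa only [Function.uncurry, hK] using this
  refine ⟨hvar, ?_⟩
  have h1 : ∫ s : Vec d, ∫ t : Vec d, varIntegrand P X a s t
      = ∫ p : Vec d × Vec d, varIntegrand P X a p.1 p.2 := (integral_prod _ hvar).symm
  rw [h1]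
  simp only [← hK]
  rw [← integral_integral_swap hint]
  refine integral_congr_ae (ae_of_all _ fun ω => ?_)
  simp only [hF, score, sq]
  exact integral_prod_mul _ _

lemma sigmaSq_eq_variance (hX : Measurable X) (hmom : Integrable (fun ω => ‖X ω‖ ^ 4) P)
    (hmean : ∫ ω, X ω ∂P = 0) (hcov : expMat P (fun ω => outer (X ω) (X ω)) = 1)
    {a : ℝ} (ha : 0 < a) :
    sigmaSq P X a = Var[fun ω => 2 * score P X a (X ω); P] := by
  rw [variance_const_mul, variance_of_integral_eq_zero
    (quadraticGrowth_score hX hmom ha).1.aemeasurable (integral_score hX hmom hmean hcov ha),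
    sigmaSq, (integrable_varIntegrand_and_integral_eq hX hmom hmean hcov ha).2]
  norm_num

end Score

/-! ### Deviations of empirical means -/

section Deviations

variable {Ω : Type*} [MeasurableSpace Ω] {P : Measure Ω} {d : ℕ} {X : Ω → Vec d}

/-- The squared deviation `(n⁻¹ ∑ⱼ f(xⱼ) - E f(X))²` for a sample `x₁, …, xₙ`. -/
noncomputable def sqDev (P : Measure Ω) (X : Ω → Vec d) {n : ℕ} (f : Vec d → ℝ)
    (x : Fin n → Vec d) : ℝ :=
  ((n : ℝ)⁻¹ * ∑ j, f (x j) - ∫ ω, f (X ω) ∂P) ^ 2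

/-- Index type of the moments that enter the linearization, see `momentFun`. -/
abbrev MomentIndex (d : ℕ) : Type :=
  (Unit ⊕ (Fin d × Fin d) ⊕ Fin d) ⊕ (Fin d ⊕ Unit ⊕ Unit)

/-- The functions of `x` whose empirical means enter the linearization: `‖x‖²`, `xᵢ xₖ`, `xᵢ`, and,
depending on `t`, also `xᵢ cos(tᵀx)`, `cos(tᵀx)` and `sin(tᵀx)`. -/
noncomputable def momentFun : MomentIndex d → Vec d → Vec d → ℝ
  | .inl (.inl _), _, x => ‖x‖ ^ 2
  | .inl (.inr (.inl (i, k))), _, x => x i * x k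
  | .inl (.inr (.inr i)), _, x => x i
  | .inr (.inl i), t, x => Real.cos (inner ℝ t x) * x i
  | .inr (.inr (.inl _)), t, x => Real.cos (inner ℝ t x)
  | .inr (.inr (.inr _)), t, x => Real.sin (inner ℝ t x)

lemma continuous_momentFun (k : MomentIndex d) :
    Continuous fun p : Vec d × Vec d => momentFun k p.1 p.2 := by
  rcases k with (_ | ⟨i, j⟩ | i) | (i | _ | _) <;> simp only [momentFun] <;> fun_prop

lemma abs_momentFun_le (k : MomentIndex d) (t x : Vec d) :
    |momentFun k t x| ≤ 1 + ‖x‖ ^ 2 := by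
  have hs := sq_nonneg ‖x‖
  rcases k with (_ | ⟨i, j⟩ | i) | (i | _ | _) <;> simp only [momentFun]
  · rw [abs_of_nonneg hs]; linarith
  · rw [abs_mul]
    have := mul_le_mul (abs_apply_le_norm x i) (abs_apply_le_norm x j) (abs_nonneg _)
      (norm_nonneg _)
    nlinarith
  · exact (abs_apply_le_norm x i).trans (le_one_add_sq _)
  · rw [abs_mul]
    exact (mul_le_of_le_one_left (abs_nonneg _) (Real.abs_cos_le_one _)).trans
      ((abs_apply_le_norm x i).trans (le_one_add_sq _))
  · linarith [Real.abs_cos_le_one (inner ℝ t x)]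
  · linarith [Real.abs_sin_le_one (inner ℝ t x)]

/-- The total squared deviation of the moments in `momentFun`. -/
noncomputable def totalSqDev (P : Measure Ω) (X : Ω → Vec d) {n : ℕ} (t : Vec d)
    (x : Fin n → Vec d) : ℝ :=
  ∑ k, sqDev P X (momentFun k t) x

/-- The total squared deviation, integrated over `t` against `(1 + ‖t‖²) exp(-a ‖t‖²)`. This
quantity controls the error of the linearization and has expectation of order `1/n`. -/
noncomputable def meanSqDev (P : Measure Ω) (X : Ω → Vec d) (a : ℝ) {n : ℕ}
    (x : Fin n → Vec d) : ℝ :=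
  ∫ t, (1 + ‖t‖ ^ 2) * weight a t * totalSqDev P X t x

lemma totalSqDev_nonneg {n : ℕ} (t : Vec d) (x : Fin n → Vec d) : 0 ≤ totalSqDev P X t x :=
  Finset.sum_nonneg fun _ _ => sq_nonneg _

variable [IsProbabilityMeasure P]

lemma measurable_totalSqDev (hX : Measurable X) {n : ℕ} :
    Measurable fun p : (Fin n → Vec d) × Vec d => totalSqDev P X p.2 p.1 := by
  unfold totalSqDev sqDev
  refine Finset.measurable_fun_sum _ fun k _ => ?_
  have hk := (continuous_momentFun k).measurable
  have h1 : Measurable fun t : Vec d => ∫ ω, momentFun k t (X ω) ∂P :=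
    (StronglyMeasurable.integral_prod_right (f := fun (t : Vec d) ω => momentFun k t (X ω))
      (hk.comp (measurable_fst.prodMk (hX.comp measurable_snd))).stronglyMeasurable).measurable
  refine Measurable.pow_const (Measurable.sub (Measurable.const_mul
    (Finset.measurable_fun_sum _ fun j _ => ?_) _) (h1.comp measurable_snd)) 2
  exact hk.comp (measurable_snd.prodMk ((measurable_pi_apply j).comp measurable_fst))

/-- For a fixed sample the deviations are bounded uniformly in `t`. -/
lemma exists_totalSqDev_le (hX : Measurable X) (hmom : Integrable (fun ω => ‖X ω‖ ^ 4) P)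
    {n : ℕ} (x : Fin n → Vec d) : ∃ B, ∀ t, totalSqDev P X t x ≤ B := by
  refine ⟨∑ _k : MomentIndex d,
    ((n : ℝ)⁻¹ * ∑ j, (1 + ‖x j‖ ^ 2) + ∫ ω, (1 + ‖X ω‖ ^ 2) ∂P) ^ 2, fun t => ?_⟩
  refine Finset.sum_le_sum fun k _ => ?_
  rw [sqDev, ← sq_abs]
  gcongr
  refine (abs_sub _ _).trans (add_le_add (abs_mean_le fun j => abs_momentFun_le k t (x j)) ?_)
  exact norm_integral_le_of_norm_le (f := fun ω => momentFun k t (X ω))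
    (integrable_of_quadratic hX hmom
      ((hX.norm.pow_const 2).const_add 1).aestronglyMeasurable fun ω => by
      rw [Real.norm_of_nonneg (by positivity)]) (ae_of_all _ fun ω => abs_momentFun_le k t (X ω))

lemma integrable_totalSqDev (hX : Measurable X) (hmom : Integrable (fun ω => ‖X ω‖ ^ 4) P)
    {a : ℝ} (ha : 0 < a) {n : ℕ} (x : Fin n → Vec d) :
    Integrable fun t : Vec d => (1 + ‖t‖ ^ 2) * weight a t * totalSqDev P X t x := by
  obtain ⟨B, hB⟩ := exists_totalSqDev_le (P := P) hX hmom x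
  refine (integrable_one_add_sq_mul_weight ha).mul_bdd (c := B)
    ((measurable_totalSqDev hX).comp measurable_prodMk_left).aestronglyMeasurable
    (ae_of_all _ fun t => ?_)
  exact (Real.norm_of_nonneg (totalSqDev_nonneg t x)).trans_le (hB t)

variable {Xs : ℕ → Ω → Vec d}

/-- The empirical mean of `f` over an i.i.d. sample has mean square error at most `n⁻¹ E f(X)²`, and
`|f(x)| ≤ 1 + ‖x‖²`. -/
lemma lintegral_sqDev_le (hX : Measurable X)
    (hindep : iIndepFun Xs P) (hident : ∀ i, IdentDistrib (Xs i) X P P)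
    (hmom : Integrable (fun ω => ‖X ω‖ ^ 4) P) {f : Vec d → ℝ} (hf : Measurable f)
    (hfb : ∀ x, |f x| ≤ 1 + ‖x‖ ^ 2) {n : ℕ} (hn : 0 < n) :
    ∫⁻ ω, ENNReal.ofReal (sqDev P X f fun j : Fin n => Xs j ω) ∂P
      ≤ ENNReal.ofReal ((n : ℝ)⁻¹ * ∫ ω, (1 + ‖X ω‖ ^ 2) ^ 2 ∂P) := by
  have hn' : (n : ℝ) ≠ 0 := by positivity
  have hidf (i : ℕ) : IdentDistrib (fun ω => f (Xs i ω)) (fun ω => f (X ω)) P P :=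
    (hident i).comp hf
  have hq : QuadraticGrowth X fun ω => f (X ω) :=
    ⟨hf.comp hX, 1, fun ω => by simpa using hfb (X ω)⟩
  have hL : MemLp (fun ω => f (X ω)) 2 P := by
    rw [memLp_two_iff_integrable_sq hq.1.aestronglyMeasurable]
    simpa only [sq] using hq.integrable_mul hX hmom hq
  have hLs (i : ℕ) : MemLp (fun ω => f (Xs i ω)) 2 P := (hidf i).memLp_iff.2 hL
  have hsum : MemLp (fun ω => (n : ℝ)⁻¹ * ∑ j : Fin n, f (Xs j ω)) 2 P :=
    (memLp_finsetSum (μ := P) (p := 2) Finset.univ fun (j : Fin n) _ => hLs j).const_mul _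
  have hmean : ∫ ω, (n : ℝ)⁻¹ * ∑ j : Fin n, f (Xs j ω) ∂P = ∫ ω, f (X ω) ∂P := by
    rw [integral_const_mul, integral_finsetSum]
    · simp only [(hidf _).integral_eq]
      simp [hn']
    · exact fun j _ => (hLs j).integrable (by simp)
  have hvar : Var[fun ω => (n : ℝ)⁻¹ * ∑ j : Fin n, f (Xs j ω); P]
      = (n : ℝ)⁻¹ * Var[fun ω => f (X ω); P] := by
    have h1 : Var[∑ j : Fin n, fun ω => f (Xs j ω); P]
        = ∑ j : Fin n, Var[fun ω => f (Xs j ω); P] := by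
      refine IndepFun.variance_sum (fun j _ => hLs j) fun i _ j _ hij => ?_
      exact (hindep.indepFun fun h => hij (Fin.ext h)).comp hf hf
    have h2 : (fun ω => ∑ j : Fin n, f (Xs j ω)) = ∑ j : Fin n, fun ω => f (Xs j ω) := by
      ext ω; simp
    rw [variance_const_mul, h2, h1]
    simp only [(hidf _).variance_eq]
    simp
    field_simp
  have hsq : Integrable (fun ω => sqDev P X f fun j : Fin n => Xs j ω) P :=
    (hsum.sub (memLp_const (∫ ω, f (X ω) ∂P))).integrable_sq
  rw [← ofReal_integral_eq_lintegral_ofReal hsq (ae_of_all _ fun ω => sq_nonneg _)]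
  refine ENNReal.ofReal_le_ofReal ?_
  have h3 : ∫ ω, sqDev P X f (fun j : Fin n => Xs j ω) ∂P
      = Var[fun ω => (n : ℝ)⁻¹ * ∑ j : Fin n, f (Xs j ω); P] := by
    rw [variance_eq_integral hsum.aestronglyMeasurable.aemeasurable, hmean]
    rfl
  rw [h3, hvar]
  gcongr
  refine (variance_le_expectation_sq hq.1.aestronglyMeasurable).trans ?_
  refine integral_mono hL.integrable_sq (integrable_one_add_sq hX hmom) fun ω => ?_
  simp only [Pi.pow_apply]
  rw [← sq_abs]
  gcongr
  exact hfb _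

lemma lintegral_totalSqDev_le (hX : Measurable X) (hXs : ∀ i, Measurable (Xs i))
    (hindep : iIndepFun Xs P) (hident : ∀ i, IdentDistrib (Xs i) X P P)
    (hmom : Integrable (fun ω => ‖X ω‖ ^ 4) P) {n : ℕ} (hn : 0 < n) (t : Vec d) :
    ∫⁻ ω, ENNReal.ofReal (totalSqDev P X t fun j : Fin n => Xs j ω) ∂P
      ≤ ENNReal.ofReal (Fintype.card (MomentIndex d)
        * ((n : ℝ)⁻¹ * ∫ ω, (1 + ‖X ω‖ ^ 2) ^ 2 ∂P)) := by
  have hsq (k : MomentIndex d) (ω : Ω) :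
      0 ≤ sqDev P X (momentFun k t) fun j : Fin n => Xs j ω := sq_nonneg _
  have hmeas (k : MomentIndex d) :
      Measurable fun ω => sqDev P X (momentFun k t) fun j : Fin n => Xs j ω := by
    have hk : Measurable (momentFun k t) :=
      (continuous_momentFun k).measurable.comp measurable_prodMk_left
    unfold sqDev
    fun_prop
  simp only [totalSqDev, ENNReal.ofReal_sum_of_nonneg fun k _ => hsq k _]
  rw [lintegral_finsetSum _ fun k _ => (hmeas k).ennreal_ofReal,
    ENNReal.ofReal_mul (Nat.cast_nonneg _), ENNReal.ofReal_natCast, ← nsmul_eq_mul,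
    ← Finset.card_univ, ← Finset.sum_const]
  exact Finset.sum_le_sum fun k _ => lintegral_sqDev_le hX hindep hident hmom
    ((continuous_momentFun k).measurable.comp measurable_prodMk_left) (abs_momentFun_le k t) hn

lemma exists_lintegral_meanSqDev_le (hX : Measurable X) (hXs : ∀ i, Measurable (Xs i))
    (hindep : iIndepFun Xs P) (hident : ∀ i, IdentDistrib (Xs i) X P P)
    (hmom : Integrable (fun ω => ‖X ω‖ ^ 4) P) {a : ℝ} (ha : 0 < a) :
    ∃ B : ℝ, ∀ n : ℕ, 0 < n →
      ∫⁻ ω, ENNReal.ofReal (meanSqDev P X a fun j : Fin n => Xs j ω) ∂P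
        ≤ ENNReal.ofReal (B / n) := by
  have hw (t : Vec d) : 0 ≤ (1 + ‖t‖ ^ 2) * weight a t :=
    mul_nonneg (by positivity) (weight_pos a t).le
  have hκ0 : 0 ≤ ∫ t : Vec d, (1 + ‖t‖ ^ 2) * weight a t := integral_nonneg hw
  have htot' := fun {n : ℕ} (hn : 0 < n) =>
    lintegral_totalSqDev_le hX hXs hindep hident hmom (n := n) hn
  generalize (Fintype.card (MomentIndex d) : ℝ) = N at htot'
  refine ⟨(∫ t : Vec d, (1 + ‖t‖ ^ 2) * weight a t) * (N * ∫ ω, (1 + ‖X ω‖ ^ 2) ^ 2 ∂P),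
    fun n hn => ?_⟩
  have htot := htot' hn
  have hmeas : Measurable fun p : Ω × Vec d =>
      totalSqDev P X p.2 fun j : Fin n => Xs j p.1 := by
    have hg : Measurable fun p : Ω × Vec d => ((fun j : Fin n => Xs j p.1), p.2) := by fun_prop
    have h := (measurable_totalSqDev (P := P) (n := n) hX).comp hg
    simpa only [Function.comp_def] using h
  calc ∫⁻ ω, ENNReal.ofReal (meanSqDev P X a fun j : Fin n => Xs j ω) ∂P
      = ∫⁻ ω, (∫⁻ t : Vec d, ENNReal.ofReal ((1 + ‖t‖ ^ 2) * weight a t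
          * totalSqDev P X t fun j : Fin n => Xs j ω)) ∂P := by
        refine lintegral_congr fun ω => ?_
        exact ofReal_integral_eq_lintegral_ofReal (integrable_totalSqDev hX hmom ha _)
          (ae_of_all _ fun t => mul_nonneg (hw t) (totalSqDev_nonneg _ _))
    _ = ∫⁻ t : Vec d, ∫⁻ ω, ENNReal.ofReal ((1 + ‖t‖ ^ 2) * weight a t
          * totalSqDev P X t fun j : Fin n => Xs j ω) ∂P := by
        refine lintegral_lintegral_swap (Measurable.aemeasurable ?_)
        simp only [Function.uncurry_def]
        have hc : Continuous fun t : Vec d => (1 + ‖t‖ ^ 2) * weight a t := by fun_prop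
        exact ENNReal.measurable_ofReal.comp ((hc.measurable.comp measurable_snd).mul hmeas)
    _ ≤ ∫⁻ t : Vec d, ENNReal.ofReal ((1 + ‖t‖ ^ 2) * weight a t)
          * ENNReal.ofReal (N * ((n : ℝ)⁻¹ * ∫ ω, (1 + ‖X ω‖ ^ 2) ^ 2 ∂P)) := by
        refine lintegral_mono fun t => ?_
        simp only [ENNReal.ofReal_mul (hw t)]
        rw [lintegral_const_mul' _ _ ENNReal.ofReal_ne_top]
        exact mul_le_mul_right (htot t) _
    _ = _ := by
        rw [lintegral_mul_const' _ _ ENNReal.ofReal_ne_top,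
          ← ofReal_integral_eq_lintegral_ofReal (integrable_one_add_sq_mul_weight ha)
            (ae_of_all _ hw), ← ENNReal.ofReal_mul hκ0]
        congr 1
        ring

end Deviations

/-! ### Linearization of the statistic -/

section Linearization

variable {Ω : Type*} [MeasurableSpace Ω] {P : Measure Ω} {d : ℕ} {X : Ω → Vec d}

lemma integral_vec_apply {f : Ω → Vec d} (hf : Integrable f P) (i : Fin d) :
    (∫ ω, f ω ∂P) i = ∫ ω, f ω i ∂P :=
  ((EuclideanSpace.proj (𝕜 := ℝ) i).integral_comp_comm hf).symm

/-- The empirical second moment operator minus the identity. -/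
noncomputable def momentOp {n : ℕ} (x : Fin n → Vec d) : Vec d →L[ℝ] Vec d :=
  toOp ((n : ℝ)⁻¹ • ∑ j, outer (x j) (x j) - 1)

lemma toOp_mean_outer {n : ℕ} (y : Fin n → Vec d) (v : Vec d) :
    toOp ((n : ℝ)⁻¹ • ∑ j, outer (y j) (y j)) v
      = (n : ℝ)⁻¹ • ∑ j, (inner ℝ (y j) v : ℝ) • y j := by
  have h : toOp (∑ j, outer (y j) (y j)) = ∑ j, toOp (outer (y j) (y j)) := map_sum _ _ _
  rw [toOp_smul, smul_apply, h, sum_apply]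
  simp only [toOp_outer]

lemma momentOp_apply {n : ℕ} (x : Fin n → Vec d) (v : Vec d) :
    momentOp x v = (n : ℝ)⁻¹ • ∑ j, (inner ℝ (x j) v : ℝ) • x j - v := by
  have h : momentOp x = toOp ((n : ℝ)⁻¹ • ∑ j, outer (x j) (x j)) - 1 := by
    rw [momentOp, toOp, map_sub, map_one]
  rw [h, sub_apply, toOp_mean_outer, one_apply_eq_self]

lemma sum_eq_smul_sampleMean {n : ℕ} (hn : 0 < n) (x : Fin n → Vec d) :
    ∑ j, x j = (n : ℝ) • sampleMean x := by
  have hn' : (n : ℝ) ≠ 0 := by positivity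
  rw [sampleMean, smul_smul, mul_inv_cancel₀ hn', one_smul]

/-- `Sₙ - 1` is the deviation of the second moments minus `b bᵀ`, for the sample mean `b`. -/
lemma toOp_sampleCov_sub_one_apply {n : ℕ} (hn : 0 < n) (x : Fin n → Vec d) (v : Vec d) :
    (toOp (sampleCov x) - 1) v
      = momentOp x v - (inner ℝ (sampleMean x) v : ℝ) • sampleMean x := by
  have hn' : (n : ℝ) ≠ 0 := by positivity
  have hsum := sum_eq_smul_sampleMean hn x
  have hsum' : ∑ j, (inner ℝ (x j) v : ℝ) = n * inner ℝ (sampleMean x) v := by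
    rw [← sum_inner, hsum, real_inner_smul_left]
  rw [sub_apply, sampleCov, toOp_mean_outer, momentOp_apply, one_apply_eq_self]
  simp only [inner_sub_left, sub_smul, smul_sub, Finset.sum_sub_distrib, ← Finset.smul_sum,
    ← Finset.sum_smul, hsum, hsum', Finset.sum_const, Finset.card_univ, Fintype.card_fin,
    smul_smul, ← Nat.cast_smul_eq_nsmul ℝ]
  field_simp
  module

lemma mean_influence {n : ℕ} (hn : 0 < n) (x : Fin n → Vec d) (t : Vec d) :
    (n : ℝ)⁻¹ * ∑ j, influence P X (x j) t
      = (n : ℝ)⁻¹ * ∑ j, Real.sin (inner ℝ t (x j)) - funI P X t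
        - funR P X t * inner ℝ t (sampleMean x)
        - 1 / 2 * inner ℝ t (momentOp x (funC P X t)) := by
  have hn' : (n : ℝ) ≠ 0 := by positivity
  simp only [influence, momentOp_apply, sampleMean, inner_sub_right, inner_smul_right, inner_sum,
    Finset.sum_sub_distrib, ← Finset.mul_sum, Finset.sum_const, Finset.card_univ,
    Fintype.card_fin, nsmul_eq_mul]
  simp only [mul_comm (inner ℝ t (x _) : ℝ)]
  field_simp

lemma norm_momentOp_sq_le (hcov : expMat P (fun ω => outer (X ω) (X ω)) = 1) {n : ℕ}
    (x : Fin n → Vec d) :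
    ‖momentOp x‖ ^ 2 ≤ ∑ p : Fin d × Fin d, sqDev P X (fun y => y p.1 * y p.2) x := by
  refine (norm_toOp_sq_le _).trans_eq ?_
  rw [Fintype.sum_prod_type]
  refine Finset.sum_congr rfl fun i _ => Finset.sum_congr rfl fun k _ => ?_
  rw [sqDev, ← hcov]
  simp [outer, expMat, Matrix.vecMulVec_apply, Matrix.sum_apply]

/-- The part of the total squared deviation that does not depend on `t`, and the rest. -/
lemma totalSqDev_eq {n : ℕ} (x : Fin n → Vec d) (t : Vec d) :
    totalSqDev P X t x
      = (sqDev P X (fun y => ‖y‖ ^ 2) x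
          + (∑ p : Fin d × Fin d, sqDev P X (fun y => y p.1 * y p.2) x
            + ∑ i, sqDev P X (fun y => y i) x))
        + (∑ i, sqDev P X (fun y => Real.cos (inner ℝ t y) * y i) x
          + (sqDev P X (fun y => Real.cos (inner ℝ t y)) x
            + sqDev P X (fun y => Real.sin (inner ℝ t y)) x)) := by
  simp only [totalSqDev, Fintype.sum_sum_type, Finset.univ_unique, Finset.sum_singleton]
  rfl

variable [IsProbabilityMeasure P]

lemma norm_sampleMean_sq (hX : Measurable X) (hmom : Integrable (fun ω => ‖X ω‖ ^ 4) P)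
    (hmean : ∫ ω, X ω ∂P = 0) {n : ℕ} (x : Fin n → Vec d) :
    ‖sampleMean x‖ ^ 2 = ∑ i, sqDev P X (fun y => y i) x := by
  rw [EuclideanSpace.real_norm_sq_eq]
  refine Finset.sum_congr rfl fun i _ => ?_
  rw [sqDev, ← integral_vec_apply (integrable_self hX hmom), hmean]
  simp [sampleMean]

lemma norm_mean_cos_smul_sub_sq (hX : Measurable X) (hmom : Integrable (fun ω => ‖X ω‖ ^ 4) P)
    {n : ℕ} (x : Fin n → Vec d) (t : Vec d) :
    ‖(n : ℝ)⁻¹ • ∑ j, Real.cos (inner ℝ t (x j)) • x j - funC P X t‖ ^ 2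
      = ∑ i, sqDev P X (fun y => Real.cos (inner ℝ t y) * y i) x := by
  rw [EuclideanSpace.real_norm_sq_eq]
  refine Finset.sum_congr rfl fun i _ => ?_
  have hint : Integrable (fun ω => Real.cos (inner ℝ t (X ω)) • X ω) P :=
    integrable_of_quadratic hX hmom (by fun_prop) fun ω => by
      rw [norm_smul]
      exact (mul_le_of_le_one_left (norm_nonneg _) (Real.abs_cos_le_one _)).trans
        (le_one_add_sq _)
  rw [sqDev, PiLp.sub_apply, funC, integral_vec_apply hint]
  simp

/-- If the deviations that do not depend on `t` are small then the integrand of the statistic is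
linear in the sample, up to a multiple of the squared deviations. -/
lemma abs_sq_mean_sin_sub_le_totalSqDev (hX : Measurable X)
    (hmom : Integrable (fun ω => ‖X ω‖ ^ 4) P) (hmean : ∫ ω, X ω ∂P = 0)
    (hcov : expMat P (fun ω => outer (X ω) (X ω)) = 1) {n : ℕ} (hn : 0 < n) (x : Fin n → Vec d)
    (hz : sqDev P X (fun y => ‖y‖ ^ 2) x
      + (∑ p : Fin d × Fin d, sqDev P X (fun y => y p.1 * y p.2) x
        + ∑ i, sqDev P X (fun y => y i) x) ≤ 1 / 16) {c M : ℝ} (hc : ∫ ω, ‖X ω‖ ∂P ≤ c)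
    (hM : (∫ ω, ‖X ω‖ ^ 2 ∂P) + 1 ≤ M) (t : Vec d) :
    |((n : ℝ)⁻¹ * ∑ j, Real.sin (inner ℝ t (residual x j))) ^ 2 - funI P X t ^ 2
        - 2 * funI P X t * ((n : ℝ)⁻¹ * ∑ j, influence P X (x j) t)|
      ≤ (1 + ‖t‖ ^ 2) * (64 * M + 14 * c + 54) * totalSqDev P X t x := by
  have hc0 : 0 ≤ c := (integral_nonneg fun ω => norm_nonneg _).trans hc
  have hM0 : 0 ≤ M := (add_nonneg (integral_nonneg fun ω => sq_nonneg _) zero_le_one).trans hM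
  have hN := norm_momentOp_sq_le (P := P) (X := X) hcov x
  have hb := norm_sampleMean_sq (P := P) hX hmom hmean x
  have hdev0 : 0 ≤ sqDev P X (fun y => ‖y‖ ^ 2) x := sq_nonneg _
  have hNb : ‖momentOp x‖ ^ 2 + ‖sampleMean x‖ ^ 2 ≤ 1 / 16 := by linarith
  have hN4 : ‖momentOp x‖ ≤ 1 / 4 :=
    abs_le_of_sq_le_sq' (by nlinarith [sq_nonneg ‖sampleMean x‖]) (by norm_num) |>.2
  have hb4 : ‖sampleMean x‖ ≤ 1 / 4 :=
    abs_le_of_sq_le_sq' (by nlinarith [sq_nonneg ‖momentOp x‖]) (by norm_num) |>.2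
  have hm : (n : ℝ)⁻¹ * ∑ j, ‖x j‖ ^ 2 ≤ M := by
    have h1 : ((n : ℝ)⁻¹ * ∑ j, ‖x j‖ ^ 2 - ∫ ω, ‖X ω‖ ^ 2 ∂P) ^ 2 ≤ 1 ^ 2 := by
      have h2 : sqDev P X (fun y => ‖y‖ ^ 2) x ≤ 1 ^ 2 := by
        linarith [sq_nonneg ‖momentOp x‖, sq_nonneg ‖sampleMean x‖]
      exact h2
    have := (abs_le_of_sq_le_sq' h1 zero_le_one).2
    linarith
  have hDapp := toOp_sampleCov_sub_one_apply hn x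
  have hDn : ‖toOp (sampleCov x) - 1‖ ≤ 1 / 2 := by
    refine ContinuousLinearMap.opNorm_le_bound _ (by norm_num) fun v => ?_
    rw [hDapp]
    refine (norm_sub_le _ _).trans ?_
    rw [norm_smul]
    have h1 := (momentOp x).le_of_opNorm_le hN4 v
    have h2 := norm_inner_le_norm (𝕜 := ℝ) (sampleMean x) v
    have h3 : ‖(inner ℝ (sampleMean x) v : ℝ)‖ * ‖sampleMean x‖ ≤ (1 / 4 * ‖v‖) * (1 / 4) :=
      mul_le_mul (h2.trans (by gcongr)) hb4 (norm_nonneg _) (by positivity)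
    linarith [norm_nonneg v]
  obtain ⟨hA1, hA2⟩ := sqrt_inv_sampleCov_perturbation x hDn
  rw [mean_influence hn]
  refine (abs_sq_mean_sin_residual_sub_le x (sampleMean x) t (funC P X t) _ (momentOp x) _
    (funI P X t) (funR P X t) _ _ hDapp hDn hA1 hA2 (by linarith) (abs_funI_le t)
    ((norm_funC_le hX hmom t).trans hc) hm).trans ?_
  refine mul_le_mul_of_nonneg_left ?_ (mul_nonneg (by positivity) (by positivity))
  rw [totalSqDev_eq, norm_mean_cos_smul_sub_sq hX hmom, hb, add_assoc, add_assoc]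
  exact add_le_add ((add_le_add_left hN _).trans (le_add_of_nonneg_left hdev0)) le_rfl

/-- If the deviations are small then, up to a multiple of their squares, the statistic is an
average of values of `2 h`. The constants do not depend on the sample size. -/
lemma exists_abs_testStat_sub_le (hX : Measurable X)
    (hmom : Integrable (fun ω => ‖X ω‖ ^ 4) P) (hmean : ∫ ω, X ω ∂P = 0)
    (hcov : expMat P (fun ω => outer (X ω) (X ω)) = 1) {a : ℝ} (ha : 0 < a) :
    ∃ K ε : ℝ, 0 ≤ K ∧ 0 < ε ∧ ∀ (n : ℕ) (x : Fin n → Vec d), 0 < n →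
      meanSqDev P X a x ≤ ε →
      |testStat a x / n - Delta P X a - (n : ℝ)⁻¹ * ∑ j, 2 * score P X a (x j)|
        ≤ K * meanSqDev P X a x := by
  set c := ∫ ω, ‖X ω‖ ∂P with hc
  set M := (∫ ω, ‖X ω‖ ^ 2 ∂P) + 1 with hM
  set κ := ∫ t : Vec d, (1 + ‖t‖ ^ 2) * weight a t with hκ
  have hc0 : 0 ≤ c := integral_nonneg fun ω => norm_nonneg _
  have hM0 : 0 ≤ M := add_nonneg (integral_nonneg fun ω => sq_nonneg _) zero_le_one
  have hw (t : Vec d) : 0 < (1 + ‖t‖ ^ 2) * weight a t :=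
    mul_pos (by positivity) (weight_pos a t)
  have hwint := integrable_one_add_sq_mul_weight (d := d) ha
  have hκ0 : 0 < κ := by
    rw [hκ, integral_pos_iff_support_of_nonneg (fun t => (hw t).le) hwint]
    have : Function.support (fun t : Vec d => (1 + ‖t‖ ^ 2) * weight a t) = Set.univ :=
      Set.eq_univ_of_forall fun t => (hw t).ne'
    rw [this]
    exact isOpen_univ.measure_pos _ Set.univ_nonempty
  -- `κ` times the deviations that do not depend on `t` is at most `meanSqDev`, so that `ε = κ / 16`
  -- bounds them by `1 / 16`, which keeps `Sₙ` within distance `1 / 2` of the identity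
  refine ⟨64 * M + 14 * c + 54, κ / 16, by positivity, by positivity, fun n x hn hx => ?_⟩
  have hn' : (n : ℝ) ≠ 0 := by positivity
  have hVint := integrable_totalSqDev (P := P) hX hmom ha x
  have hz : sqDev P X (fun y => ‖y‖ ^ 2) x
      + (∑ p : Fin d × Fin d, sqDev P X (fun y => y p.1 * y p.2) x
        + ∑ i, sqDev P X (fun y => y i) x) ≤ 1 / 16 := by
    set z := sqDev P X (fun y => ‖y‖ ^ 2) x
      + (∑ p : Fin d × Fin d, sqDev P X (fun y => y p.1 * y p.2) x
        + ∑ i, sqDev P X (fun y => y i) x) with hz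
    have h : κ * z ≤ meanSqDev P X a x := by
      rw [hκ, ← integral_mul_const]
      refine integral_mono (hwint.mul_const z) hVint fun t => ?_
      refine mul_le_mul_of_nonneg_left ?_ (hw t).le
      rw [totalSqDev_eq, ← hz]
      refine le_add_of_nonneg_right (add_nonneg (Finset.sum_nonneg fun _ _ => sq_nonneg _)
        (add_nonneg (sq_nonneg _) (sq_nonneg _)))
    have : κ * z ≤ κ * (1 / 16) := by linarith
    exact le_of_mul_le_mul_left this hκ0
  have hpt := abs_sq_mean_sin_sub_le_totalSqDev hX hmom hmean hcov hn x hz hc.ge hM.ge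
  -- integration against the weight
  have hw1 := integrable_weight (d := d) ha
  have hg : Integrable fun t : Vec d =>
      ((n : ℝ)⁻¹ * ∑ j, Real.sin (inner ℝ t (residual x j))) ^ 2 * weight a t := by
    refine hw1.bdd_mul (c := 1) (by fun_prop) (ae_of_all _ fun t => ?_)
    rw [Real.norm_of_nonneg (sq_nonneg _), sq_le_one_iff_abs_le_one]
    refine (abs_mean_le (g := fun _ => 1) fun j => Real.abs_sin_le_one _).trans_eq ?_
    simp [hn']
  have hI : Integrable fun t : Vec d => funI P X t ^ 2 * weight a t := by
    refine hw1.bdd_mul (c := 1) ((measurable_funI hX).pow_const 2).aestronglyMeasurable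
      (ae_of_all _ fun t => ?_)
    rw [Real.norm_of_nonneg (sq_nonneg _), sq_le_one_iff_abs_le_one]
    exact abs_funI_le t
  have hS : Integrable fun t : Vec d => (n : ℝ)⁻¹ * ∑ j, 2 * scoreIntegrand P X a (x j) t :=
    (integrable_finsetSum _ fun j _ =>
      (integrable_scoreIntegrand hX hmom ha (x j)).const_mul 2).const_mul _
  have hT : testStat a x / n = ∫ t : Vec d,
      ((n : ℝ)⁻¹ * ∑ j, Real.sin (inner ℝ t (residual x j))) ^ 2 * weight a t := by
    rw [testStat, ← integral_div]
    refine integral_congr_ae (ae_of_all _ fun t => ?_)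
    simp only [weight]
    rw [mul_pow, mul_pow, div_pow, Real.sq_sqrt (Nat.cast_nonneg n)]
    field_simp
  have hScore : (n : ℝ)⁻¹ * ∑ j, 2 * score P X a (x j)
      = ∫ t : Vec d, (n : ℝ)⁻¹ * ∑ j, 2 * scoreIntegrand P X a (x j) t := by
    rw [integral_const_mul, integral_finsetSum _ fun j _ =>
      (integrable_scoreIntegrand hX hmom ha (x j)).const_mul 2]
    simp only [integral_const_mul, score]
  have hDelta : Delta P X a = ∫ t : Vec d, funI P X t ^ 2 * weight a t := rfl
  have hgI : Integrable fun t : Vec d =>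
      ((n : ℝ)⁻¹ * ∑ j, Real.sin (inner ℝ t (residual x j))) ^ 2 * weight a t
        - funI P X t ^ 2 * weight a t := hg.sub hI
  rw [hT, hScore, hDelta, ← integral_sub hg hI, ← integral_sub hgI hS, meanSqDev,
    ← integral_const_mul, ← Real.norm_eq_abs]
  refine norm_integral_le_of_norm_le (hVint.const_mul _) (ae_of_all _ fun t => ?_)
  have hwt := weight_pos a t
  have e : ((n : ℝ)⁻¹ * ∑ j, Real.sin (inner ℝ t (residual x j))) ^ 2 * weight a t
      - funI P X t ^ 2 * weight a t - (n : ℝ)⁻¹ * ∑ j, 2 * scoreIntegrand P X a (x j) t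
      = (((n : ℝ)⁻¹ * ∑ j, Real.sin (inner ℝ t (residual x j))) ^ 2 - funI P X t ^ 2
        - 2 * funI P X t * ((n : ℝ)⁻¹ * ∑ j, influence P X (x j) t)) * weight a t := by
    simp only [scoreIntegrand, ← Finset.mul_sum, ← Finset.sum_mul]
    ring
  rw [e, norm_mul, Real.norm_of_nonneg hwt.le]
  refine (mul_le_mul_of_nonneg_right (hpt t) hwt.le).trans_eq ?_
  ring

end Linearization

/-! ### Convergence of the remainder -/

/-- If the positive part of `Zₙ` has expectation of order `1/n`, and `Rₙ` is at most a multiple of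
`√n Zₙ` whenever `Zₙ` is small, then `Rₙ → 0` in probability. -/
lemma tendstoInMeasure_zero_of_le_sqrt_mul {Ω : Type*} [MeasurableSpace Ω] {P : Measure Ω}
    {R Z : ℕ → Ω → ℝ} (hZ : ∀ n, AEMeasurable (Z n) P) {B K ε : ℝ} (hK : 0 ≤ K)
    (hε : 0 < ε)
    (hZB : ∀ n : ℕ, 0 < n → ∫⁻ ω, ENNReal.ofReal (Z n ω) ∂P ≤ ENNReal.ofReal (B / n))
    (hR : ∀ n : ℕ, 0 < n → ∀ ω, Z n ω ≤ ε → |R n ω| ≤ √(n : ℝ) * (K * Z n ω)) :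
    TendstoInMeasure P R atTop 0 := by
  rw [tendstoInMeasure_iff_norm]
  intro δ hδ
  have hlim : Tendsto (fun n : ℕ => ENNReal.ofReal (B / ε * (n : ℝ)⁻¹)
      + ENNReal.ofReal (B * (K + 1) / δ * (√(n : ℝ))⁻¹)) atTop (nhds 0) := by
    have h1 : Tendsto (fun n : ℕ => B / ε * (n : ℝ)⁻¹) atTop (nhds 0) := by
      simpa using tendsto_inv_atTop_nhds_zero_nat.const_mul (B / ε)
    have h2 : Tendsto (fun n : ℕ => B * (K + 1) / δ * (√(n : ℝ))⁻¹) atTop (nhds 0) := by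
      simpa using (tendsto_inv_atTop_zero.comp (Real.tendsto_sqrt_atTop.comp
        tendsto_natCast_atTop_atTop)).const_mul (B * (K + 1) / δ)
    simpa using (ENNReal.tendsto_ofReal h1).add (ENNReal.tendsto_ofReal h2)
  refine tendsto_of_tendsto_of_tendsto_of_le_of_le' tendsto_const_nhds hlim
    (Eventually.of_forall fun n => zero_le) ?_
  filter_upwards [eventually_gt_atTop 0] with n hn
  have hs : 0 < √(n : ℝ) := Real.sqrt_pos.2 (by exact_mod_cast hn)
  have markov (r : ℝ) (hr : 0 < r) :
      P {ω | ENNReal.ofReal r ≤ ENNReal.ofReal (Z n ω)} ≤ ENNReal.ofReal (B / n / r) := by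
    rw [ENNReal.ofReal_div_of_pos hr,
      ENNReal.le_div_iff_mul_le (Or.inl (by simpa using hr)) (Or.inl ENNReal.ofReal_ne_top),
      mul_comm]
    exact (mul_meas_ge_le_lintegral₀ (hZ n).ennreal_ofReal _).trans (hZB n hn)
  have hδK : 0 < δ / ((K + 1) * √(n : ℝ)) := by positivity
  have hsub : {ω | δ ≤ ‖R n ω - (0 : ℕ → Ω → ℝ) n ω‖}
      ⊆ {ω | ENNReal.ofReal ε ≤ ENNReal.ofReal (Z n ω)}
        ∪ {ω | ENNReal.ofReal (δ / ((K + 1) * √(n : ℝ))) ≤ ENNReal.ofReal (Z n ω)} := by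
    intro ω hω
    simp only [Set.mem_ofPred_eq, Pi.zero_apply, sub_zero, Real.norm_eq_abs] at hω
    by_cases hZε : Z n ω ≤ ε
    · right
      have h1 := hω.trans (hR n hn ω hZε)
      have hZ0 : 0 ≤ Z n ω := by
        by_contra hneg
        push Not at hneg
        have : √(n : ℝ) * (K * Z n ω) ≤ 0 :=
          mul_nonpos_of_nonneg_of_nonpos hs.le (mul_nonpos_of_nonneg_of_nonpos hK hneg.le)
        linarith
      refine ENNReal.ofReal_le_ofReal ?_
      rw [div_le_iff₀ (by positivity)]
      nlinarith [mul_nonneg hs.le hZ0]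
    · left
      exact ENNReal.ofReal_le_ofReal (not_le.1 hZε).le
  refine (measure_mono hsub).trans ((measure_union_le _ _).trans
    (add_le_add ((markov ε hε).trans_eq ?_) ((markov _ hδK).trans_eq ?_)))
  · congr 1; field_simp
  · congr 1
    have hsq : √(n : ℝ) * √(n : ℝ) = n := Real.mul_self_sqrt (Nat.cast_nonneg n)
    have hn' : (n : ℝ) ≠ 0 := by positivity
    field_simp
    rw [sq, hsq]

end HKM

theorem theorem3 {Ω : Type*} [MeasurableSpace Ω] (P : Measure Ω) [IsProbabilityMeasure P]
    (d : ℕ) (hd : 1 ≤ d) (a : ℝ) (ha : 0 < a)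
    -- `X, X₁, X₂, …` are identically distributed, and `X₁, X₂, …` are independent
    (X : Ω → HKM.Vec d) (Xs : ℕ → Ω → HKM.Vec d)
    (hX : Measurable X) (hXs : ∀ i, Measurable (Xs i))
    (hindep : iIndepFun Xs P) (hident : ∀ i, IdentDistrib (Xs i) X P P)
    -- the distribution of `X` is absolutely continuous, standardized and not symmetric
    (hac : P.map X ≪ volume)
    (hmom : Integrable (fun ω => ‖X ω‖ ^ 4) P)
    (hmean : ∫ ω, X ω ∂P = 0)
    (hcov : HKM.expMat P (fun ω => HKM.outer (X ω) (X ω)) = 1)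
    (hsymm : ¬ HKM.ReflectedSymmetric P X) :
    Integrable (fun p : HKM.Vec d × HKM.Vec d => HKM.varIntegrand P X a p.1 p.2) ∧
    0 ≤ HKM.sigmaSq P X a ∧
    TendstoInDistribution
      (fun (n : ℕ) (ω : Ω) =>
        √(n : ℝ) * (HKM.testStat a (fun j : Fin n => Xs j ω) / n - HKM.Delta P X a))
      atTop id (fun _ => P) (gaussianReal 0 (HKM.sigmaSq P X a).toNNReal) := by
  have hvar := HKM.sigmaSq_eq_variance hX hmom hmean hcov ha
  refine ⟨(HKM.integrable_varIntegrand_and_integral_eq hX hmom hmean hcov ha).1, hvar ▸ variance_nonneg _ _, ?_⟩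
  have hscore : Measurable fun x : HKM.Vec d => 2 * HKM.score P X a x :=
    (HKM.measurable_score hX a).const_mul 2
  have hid (i : ℕ) : IdentDistrib (fun ω => 2 * HKM.score P X a (Xs i ω))
      (fun ω => 2 * HKM.score P X a (X ω)) P P := (hident i).comp hscore
  have hL : MemLp (fun ω => 2 * HKM.score P X a (X ω)) 2 P :=
    (HKM.memLp_score hX hmom ha).const_mul 2
  -- the central limit theorem for the linear part
  have hclt := tendstoInDistribution_inv_sqrt_mul_sum_sub (P := P)
    (P' := gaussianReal 0 (HKM.sigmaSq P X a).toNNReal) (Y := id)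
    (X := fun i ω => 2 * HKM.score P X a (Xs i ω))
    (by rw [(hid 0).variance_eq, ← hvar]; exact ⟨aemeasurable_id, Measure.map_id⟩)
    ((hid 0).memLp_iff.2 hL)
    (hindep.comp (fun _ x => 2 * HKM.score P X a x) fun _ => hscore)
    (fun i => (hid i).trans (hid 0).symm)
  have hmean0 : ∫ ω, 2 * HKM.score P X a (Xs 0 ω) ∂P = 0 := by
    rw [(hid 0).integral_eq, integral_const_mul, HKM.integral_score hX hmom hmean hcov ha, mul_zero]
  simp only [hmean0, mul_zero, sub_zero] at hclt
  obtain ⟨B, hZB⟩ := HKM.exists_lintegral_meanSqDev_le hX hXs hindep hident hmom ha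
  obtain ⟨K, ε, hK, hε, hR⟩ := HKM.exists_abs_testStat_sub_le hX hmom hmean hcov ha
  refine tendstoInDistribution_of_tendstoInMeasure_sub _ _ hclt ?_ fun n => ?_
  · refine HKM.tendstoInMeasure_zero_of_le_sqrt_mul
      (Z := fun n ω => HKM.meanSqDev P X a fun j : Fin n => Xs j ω) (fun n => ?_) hK hε hZB
      fun n hn ω hω => ?_
    · have hw : Continuous fun t : HKM.Vec d => (1 + ‖t‖ ^ 2) * HKM.weight a t := by fun_prop
      have h1 : StronglyMeasurable fun x : Fin n → HKM.Vec d => HKM.meanSqDev P X a x :=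
        StronglyMeasurable.integral_prod_right (f := fun (x : Fin n → HKM.Vec d) (t : HKM.Vec d) =>
          (1 + ‖t‖ ^ 2) * HKM.weight a t * HKM.totalSqDev P X t x)
          ((hw.measurable.comp measurable_snd).mul
            (HKM.measurable_totalSqDev hX)).stronglyMeasurable
      have h2 : Measurable fun ω => fun j : Fin n => Xs j ω := by fun_prop
      exact (h1.measurable.comp h2).aemeasurable
    · have h := hR n (fun j : Fin n => Xs j ω) hn hω
      have hs : 0 < √(n : ℝ) := Real.sqrt_pos.2 (by exact_mod_cast hn)
      have hinv : (√(n : ℝ))⁻¹ = √(n : ℝ) * (n : ℝ)⁻¹ := by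
        have hsq : √(n : ℝ) * √(n : ℝ) = n := Real.mul_self_sqrt (Nat.cast_nonneg n)
        have hn' : (n : ℝ) ≠ 0 := by positivity
        field_simp
        rw [sq, hsq]
      simp only [Pi.sub_apply]
      rw [hinv, mul_assoc, ← mul_sub, abs_mul, abs_of_pos hs,
        ← Fin.sum_univ_eq_sum_range (fun j => 2 * HKM.score P X a (Xs j ω))]
      gcongr
  · have h2 : Measurable fun ω => fun j : Fin n => Xs j ω := by fun_prop
    exact ((((HKM.measurable_testStat a).comp h2).div_const _).sub_const _).const_mul _
      |>.aemeasurable
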